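/- Let $\Omega_1,\Omega_2\subset\mathbb{C}^n$ be bounded domains with $C^2$-smooth boundary, i.e. $\Omega_k=\{r_k<0\}$ is connected and bounded, where $r_k$ is a real-valued $C^2$ function on $\mathbb{C}^n$ with $dr_k\neq0$ on $b\Omega_k$. Let $d_k$ be the Euclidean distance to $b\Omega_k$ and let $\delta_k$ be the signed distance, $\delta_k=-d_k$ in $\Omega_k$ and $\delta_k=d_k$ in $\mathbb{C}^n\setminus\Omega_k$; it is $C^2$ near $b\Omega_k$. For $p\in\Omega_1$ near $b\Omega_1$ let $$N_{1p}=2\sqrt2\sum_{j=1}^n\frac{\partial\delta_1}{\partial\bar z_j}(p)\,\frac{\partial}{\partial z_j}$$ be the complex normal direction; $(1,0)$-vectors are identified with vectors in $\mathbb{C}^n$, and $\langle\partial\delta_2(q),X\rangle=\sum_{j}\frac{\partial\delta_2}{\partial z_j}(q)X_j$. Let $\Phi\colon\Omega_1\to\Omega_2$ be a proper holomorphic map which uniformly preserves the complex normal direction: there are a neighborhood $U$ of $b\Omega_1$ and a constant $C>0$ such that $$\|\Phi_{*p}(N_{1p})\|\le C\,\bigl|\langle\partial\delta_2(\Phi(p)),\Phi_{*p}(N_{1p})\rangle\bigr|\qquad\text{for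 all }p\in\Omega_1\cap U .$$ Suppose moreover that for some $\alpha\in(0,1]$ there is a constant $C>0$ with $$d_2(\Phi(z))\le C\,d_1(z)^{\alpha}\qquad\text{for all }z\in\Omega_1 .$$ Then $\Phi\in\operatorname{Lip}_{\alpha/2}(\Omega_1)$, i.e. $\Phi$ is bounded and there is a constant $C$ such that $\|\Phi(z)-\Phi(w)\|\le C\|z-w\|^{\alpha/2}$ for all $z,w\in\Omega_1$. -/

import Mathlib

noncomputable section

namespace NormalMapping

/-- Complex Euclidean space `ℂⁿ` with its Hermitian norm. -/
abbrev Cn (n : ℕ) : Type := EuclideanSpace ℂ (Fin n)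

/-- A bounded domain (nonempty connected open set) in `ℂⁿ` with `C²`-smooth boundary: it is
`{r < 0}` for a real-valued `C²` function `r` with `dr ≠ 0` on the boundary. -/
structure IsBoundedC2Domain {n : ℕ} (Ω : Set (Cn n)) : Prop where
  isOpen : IsOpen Ω
  isConnected : IsConnected Ω
  isBounded : Bornology.IsBounded Ω
  exists_definingFunction : ∃ r : Cn n → ℝ, ContDiff ℝ 2 r ∧ Ω = {z | r z < 0} ∧
    ∀ z ∈ frontier Ω, fderiv ℝ r z ≠ 0

/-- The Euclidean distance to the boundary of `Ω`. -/
def bdryDist {n : ℕ} (Ω : Set (Cn n)) (z : Cn n) : ℝ := Metric.infDist z (frontier Ω)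

open Classical in
/-- The signed Euclidean distance to the boundary of `Ω`, negative in `Ω`. -/
def signedDist {n : ℕ} (Ω : Set (Cn n)) (z : Cn n) : ℝ :=
  if z ∈ Ω then -bdryDist Ω z else bdryDist Ω z

/-- `∂u/∂x_j` at `p`, where `z_j = x_j + i y_j`. -/
def partialX {n : ℕ} (u : Cn n → ℝ) (p : Cn n) (j : Fin n) : ℝ :=
  fderiv ℝ u p (EuclideanSpace.single j 1)

/-- `∂u/∂y_j` at `p`, where `z_j = x_j + i y_j`. -/
def partialY {n : ℕ} (u : Cn n → ℝ) (p : Cn n) (j : Fin n) : ℝ :=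
  fderiv ℝ u p (EuclideanSpace.single j Complex.I)

/-- `∂u/∂z_j = (∂u/∂x_j - i ∂u/∂y_j) / 2` at `p`. -/
def partialZ {n : ℕ} (u : Cn n → ℝ) (p : Cn n) (j : Fin n) : ℂ :=
  ((partialX u p j : ℂ) - Complex.I * (partialY u p j : ℂ)) / 2

/-- `∂u/∂z̄_j = (∂u/∂x_j + i ∂u/∂y_j) / 2` at `p`. -/
def partialZBar {n : ℕ} (u : Cn n → ℝ) (p : Cn n) (j : Fin n) : ℂ :=
  ((partialX u p j : ℂ) + Complex.I * (partialY u p j : ℂ)) / 2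

/-- The pairing `⟨∂u(p), X⟩ = ∑ⱼ ∂u/∂z_j(p) X_j` with the `(1,0)`-vector `X = ∑ⱼ X_j ∂/∂z_j`,
identified with the vector `(X_1, …, X_n)` of `ℂⁿ`. -/
def delPairing {n : ℕ} (u : Cn n → ℝ) (p X : Cn n) : ℂ :=
  ∑ j, partialZ u p j * X j

/-- The complex normal direction `N_p = 2√2 ∑ⱼ ∂δ/∂z̄_j(p) ∂/∂z_j` of `Ω`, where `δ` is the
signed distance to the boundary, as a vector of `ℂⁿ`. It is meant for `p` near the boundary. -/
def complexNormal {n : ℕ} (Ω : Set (Cn n)) (p : Cn n) : Cn n :=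
  WithLp.toLp 2 fun j => 2 * (Real.sqrt 2 : ℂ) * partialZBar (signedDist Ω) p j

/-- `Φ` is a proper holomorphic map from `Ω₁` to `Ω₂`. -/
def IsProperHolomorphic {n : ℕ} (Φ : Cn n → Cn n) (Ω₁ Ω₂ : Set (Cn n)) : Prop :=
  DifferentiableOn ℂ Φ Ω₁ ∧ ∃ h : Set.MapsTo Φ Ω₁ Ω₂, IsProperMap (h.restrict Φ Ω₁ Ω₂)

/-- `Φ` uniformly preserves the complex normal direction: near the boundary of `Ω₁`,
`‖Φ_{*p}(N_{1p})‖ ≤ C |⟨∂δ₂(Φ(p)), Φ_{*p}(N_{1p})⟩|`. -/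
def UniformlyPreservesComplexNormal {n : ℕ} (Φ : Cn n → Cn n) (Ω₁ Ω₂ : Set (Cn n)) : Prop :=
  ∃ U : Set (Cn n), IsOpen U ∧ frontier Ω₁ ⊆ U ∧ ∃ C : ℝ, 0 < C ∧ ∀ p ∈ Ω₁ ∩ U,
    ‖fderiv ℂ Φ p (complexNormal Ω₁ p)‖ ≤
      C * ‖delPairing (signedDist Ω₂) (Φ p) (fderiv ℂ Φ p (complexNormal Ω₁ p))‖

/-- The boundary distances satisfy `d₂(Φ(z)) ≤ C d₁(z)^α` on `Ω₁` for some `C > 0`. -/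
def BoundaryDistanceProperty {n : ℕ} (Φ : Cn n → Cn n) (Ω₁ Ω₂ : Set (Cn n)) (α : ℝ) : Prop :=
  ∃ C : ℝ, 0 < C ∧ ∀ z ∈ Ω₁, bdryDist Ω₂ (Φ z) ≤ C * bdryDist Ω₁ z ^ α

/-- `f` belongs on `Ω` to the Lipschitz class of order `β`, for `0 < β < 1`: it is bounded
and Hölder continuous with exponent `β`. -/
def InLip {n : ℕ} (β : ℝ) (f : Cn n → Cn n) (Ω : Set (Cn n)) : Prop :=
  (∃ M : ℝ, ∀ z ∈ Ω, ‖f z‖ ≤ M) ∧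
    ∃ C : ℝ, ∀ z ∈ Ω, ∀ w ∈ Ω, ‖f z - f w‖ ≤ C * ‖z - w‖ ^ β

end NormalMapping

end

/-!
Let `r₂` be a defining function of `Ω₂`. On the ball of radius `d₁(p)` about `p` the function
`-r₂ ∘ Φ` is nonnegative and, by the Schwarz lemma for the bounded map `Φ`, differs from its first
order expansion by at most a constant times `(‖v‖ / d₁(p))²`. Landau's inequality turns this into
`‖d(d₂ ∘ Φ)(p)‖ ≲ √d₂(Φ(p)) / d₁(p) ≲ d₁(p) ^ (α / 2 - 1)`, and preservation of the complex normal
carries the bound over to the derivative of `Φ` in the normal direction.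

Tangential derivatives follow by integrating along `-∇r₁`: the Schwarz lemma bounds the variation of
the normal derivative by `d₁ ^ (α / 2 - 2)`, and the integral of this over a path leading into the
domain is again of order `d₁ ^ (α / 2 - 1)`. The Hardy–Littlewood lemma concludes.

The distance to the boundary is only differentiated where it is differentiable: these points are
dense by Rademacher's theorem, and the resulting inequality between the continuous functions
`‖DΦ (∇r₁)‖` and `d₁ ^ (α / 2 - 1)` extends to all of `Ω₁`.
-/

namespace NormalMapping

open Bornology Metric Set Filter Topology Asymptotics
open scoped NNReal Gradient RealInnerProductSpace

/-! ### Bounded holomorphic maps on balls -/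

theorem hasDerivAt_comp_add_smul {𝕜 E F : Type*} [NontriviallyNormedField 𝕜]
    [NormedAddCommGroup E] [NormedSpace 𝕜 E] [NormedAddCommGroup F] [NormedSpace 𝕜 F]
    {f : E → F} {f' : E →L[𝕜] F} {x v : E} {s : 𝕜} (hf : HasFDerivAt f f' (x + s • v)) :
    HasDerivAt (fun s => f (x + s • v)) (f' v) s :=
  hf.comp_hasDerivAt s (by simpa using ((hasDerivAt_id s).smul_const v).const_add x)

section Holomorphic

variable {E F : Type*} [NormedAddCommGroup E] [NormedAddCommGroup F] {Φ : E → F} {a : E} {ρ M : ℝ}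

theorem mapsTo_ball_closedBall (hρ : 0 < ρ) (hM : ∀ x ∈ ball a ρ, ‖Φ x‖ ≤ M) :
    MapsTo Φ (ball a ρ) (closedBall (Φ a) (2 * M)) := fun x hx => by
  rw [mem_closedBall, dist_eq_norm]
  linarith [norm_sub_le (Φ x) (Φ a), hM x hx, hM a (mem_ball_self hρ)]

variable [NormedSpace ℂ E] [NormedSpace ℂ F]

theorem norm_fderiv_le_of_norm_le (hρ : 0 < ρ) (hd : DifferentiableOn ℂ Φ (ball a ρ))
    (hM : ∀ x ∈ ball a ρ, ‖Φ x‖ ≤ M) : ‖fderiv ℂ Φ a‖ ≤ 2 * M / ρ :=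
  Complex.norm_fderiv_le_div_of_mapsTo_ball hd (mapsTo_ball_closedBall hρ hM) hρ

theorem norm_add_sub_le_of_norm_le (hd : DifferentiableOn ℂ Φ (ball a ρ))
    (hM : ∀ x ∈ ball a ρ, ‖Φ x‖ ≤ M) {v : E} (hv : ‖v‖ < ρ) :
    ‖Φ (a + v) - Φ a‖ ≤ 2 * M / ρ * ‖v‖ := by
  have h := Complex.dist_le_div_mul_dist_of_mapsTo_ball hd
    (mapsTo_ball_closedBall ((norm_nonneg v).trans_lt hv) hM) (z := a + v) (by simpa using hv)
  simpa [dist_eq_norm] using h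

/-- The remainder is `o(‖v‖)`, so the higher order Schwarz lemma makes it quadratic. -/
theorem norm_add_sub_sub_fderiv_le (hd : DifferentiableOn ℂ Φ (ball a ρ))
    (hM : ∀ x ∈ ball a ρ, ‖Φ x‖ ≤ M) {v : E} (hv : ‖v‖ < ρ) :
    ‖Φ (a + v) - Φ a - fderiv ℂ Φ a v‖ ≤ 4 * M / ρ ^ 2 * ‖v‖ ^ 2 := by
  have hρ : 0 < ρ := (norm_nonneg v).trans_lt hv
  set R : E → F := fun x => Φ x - fderiv ℂ Φ a (x - a)
  have hR : DifferentiableOn ℂ R (ball a ρ) := hd.sub (by fun_prop)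
  have hmaps : MapsTo R (ball a ρ) (closedBall (R a) (4 * M)) := fun x hx => by
    have hlin : ‖fderiv ℂ Φ a (x - a)‖ ≤ 2 * M := by
      calc ‖fderiv ℂ Φ a (x - a)‖ ≤ 2 * M / ρ * ρ :=
            (fderiv ℂ Φ a).le_of_opNorm_le_of_le (norm_fderiv_le_of_norm_le hρ hd hM)
              (mem_ball_iff_norm.1 hx).le
        _ = 2 * M := by field_simp
    have hΦ := mem_closedBall_iff_norm.1 (mapsTo_ball_closedBall hρ hM hx)
    rw [mem_closedBall_iff_norm]
    calc ‖R x - R a‖ = ‖(Φ x - Φ a) - fderiv ℂ Φ a (x - a)‖ := by simp [R, sub_right_comm]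
      _ ≤ 4 * M := by linarith [norm_sub_le (Φ x - Φ a) (fderiv ℂ Φ a (x - a))]
  have ho : (fun x => R x - R a) =o[𝓝 a] fun x => ‖x - a‖ ^ 1 := by
    have := (hd.differentiableAt (ball_mem_nhds a hρ)).hasFDerivAt.isLittleO.norm_right
    simpa [R, sub_right_comm] using this
  have h := Complex.dist_le_mul_div_pow_of_mapsTo_ball_of_isLittleO hR hmaps ho
    (z := a + v) (by simpa using hv)
  calc ‖Φ (a + v) - Φ a - fderiv ℂ Φ a v‖ = dist (R (a + v)) (R a) := by
        simp [R, dist_eq_norm, sub_right_comm]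
    _ ≤ 4 * M * (dist (a + v) a / ρ) ^ (1 + 1) := h
    _ = 4 * M / ρ ^ 2 * ‖v‖ ^ 2 := by simp [dist_eq_norm]; ring

theorem norm_add_smul_sub_le_of_norm_fderiv_apply_le {x e : E} {B : ℝ}
    (hd : DifferentiableOn ℂ Φ (ball x ρ)) (hB : ∀ y ∈ ball x ρ, ‖fderiv ℂ Φ y e‖ ≤ B) {σ : ℂ}
    (hσ : ‖σ • e‖ < ρ) : ‖Φ (x + σ • e) - Φ x‖ ≤ B * ‖σ‖ := by
  have hmem : ∀ t ∈ Icc (0 : ℝ) 1, x + t • σ • e ∈ ball x ρ := fun t ht => by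
    rw [mem_ball_iff_norm, add_sub_cancel_left, norm_smul, Real.norm_of_nonneg ht.1]
    nlinarith [ht.2, norm_nonneg (σ • e)]
  have hderiv : ∀ t ∈ Icc (0 : ℝ) 1, HasDerivAt (fun t : ℝ => Φ (x + t • σ • e))
      (σ • fderiv ℂ Φ (x + t • σ • e) e) t := fun t ht => by
    have hΦ := (hd.differentiableAt (isOpen_ball.mem_nhds (hmem t ht))).hasFDerivAt
    simpa using hasDerivAt_comp_add_smul (hΦ.restrictScalars ℝ)
  have h := norm_image_sub_le_of_norm_deriv_le_segment_01' (C := B * ‖σ‖)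
    (fun t ht => (hderiv t ht).hasDerivWithinAt) fun t ht => by
      rw [norm_smul, mul_comm]
      gcongr
      exact hB _ (hmem t (Ico_subset_Icc_self ht))
  simpa using h

/-- For fixed small `σ` the Schwarz lemma applies to the difference `Φ (x + σ • e) - Φ x`, which
the mean value inequality bounds by `B * ‖σ‖`; dividing by `σ` gives the derivative. -/
theorem norm_fderiv_apply_sub_le {b e : E} {B : ℝ} (hd : DifferentiableOn ℂ Φ (ball a ρ))
    (hB : ∀ x ∈ ball a ρ, ‖fderiv ℂ Φ x e‖ ≤ B) (hb : b ∈ ball a (ρ / 2)) :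
    ‖fderiv ℂ Φ b e - fderiv ℂ Φ a e‖ ≤ 4 * B / ρ * dist b a := by
  have hρ : 0 < ρ / 2 := pos_of_mem_ball hb
  have hρ' : 0 < ρ := by linarith
  have hB₀ : 0 ≤ B := (norm_nonneg _).trans (hB a (mem_ball_self hρ'))
  have hsub : ∀ x ∈ ball a (ρ / 2), ball x (ρ / 2) ⊆ ball a ρ := fun x hx =>
    ball_subset_ball' (by linarith [mem_ball.1 hx])
  have hderiv : ∀ x ∈ ball a (ρ / 2),
      HasDerivAt (fun σ : ℂ => Φ (x + σ • e) - Φ x) (fderiv ℂ Φ x e) 0 := fun x hx => by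
    have hΦ := (hd.differentiableAt
      (isOpen_ball.mem_nhds (hsub x hx (mem_ball_self hρ)))).hasFDerivAt
    exact (hasDerivAt_comp_add_smul (by simpa using hΦ)).sub_const _
  refine ((hderiv b hb).sub (hderiv a (mem_ball_self hρ))).le_of_lip' (by positivity) ?_
  have hsmall : ∀ᶠ σ in 𝓝 (0 : ℂ), ‖σ • e‖ < ρ / 2 :=
    (by fun_prop : Continuous fun σ : ℂ => ‖σ • e‖).continuousAt.eventually_lt
      continuousAt_const (by simpa using hρ)
  filter_upwards [hsmall] with σ hσ
  have hbound : ∀ x ∈ ball a (ρ / 2), ‖Φ (x + σ • e) - Φ x‖ ≤ B * ‖σ‖ := fun x hx =>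
    norm_add_smul_sub_le_of_norm_fderiv_apply_le (hd.mono (hsub x hx))
      (fun y hy => hB y (hsub x hx hy)) hσ
  have hdiff : DifferentiableOn ℂ (fun x => Φ (x + σ • e) - Φ x) (ball a (ρ / 2)) :=
    (hd.comp (by fun_prop) fun x hx => hsub x hx (by simpa using hσ)).sub
      (hd.mono (ball_subset_ball (by linarith)))
  have h := Complex.dist_le_div_mul_dist_of_mapsTo_ball hdiff (mapsTo_ball_closedBall hρ hbound) hb
  calc _ = dist (Φ (b + σ • e) - Φ b) (Φ (a + σ • e) - Φ a) := by simp [dist_eq_norm]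
    _ ≤ 2 * (B * ‖σ‖) / (ρ / 2) * dist b a := h
    _ = 4 * B / ρ * dist b a * ‖σ - 0‖ := by rw [sub_zero]; field_simp; ring

theorem continuousAt_fderiv (hρ : 0 < ρ) (hd : DifferentiableOn ℂ Φ (ball a ρ))
    (hM : ∀ x ∈ ball a ρ, ‖Φ x‖ ≤ M) : ContinuousAt (fderiv ℂ Φ) a := by
  have hM₀ : 0 ≤ M := (norm_nonneg _).trans (hM a (mem_ball_self hρ))
  have hbound : ∀ e, ∀ x ∈ ball a (ρ / 2), ‖fderiv ℂ Φ x e‖ ≤ 2 * M / (ρ / 2) * ‖e‖ :=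
    fun e x hx => by
      have hsub : ball x (ρ / 2) ⊆ ball a ρ := ball_subset_ball' (by linarith [mem_ball.1 hx])
      exact (fderiv ℂ Φ x).le_of_opNorm_le (norm_fderiv_le_of_norm_le (by positivity)
        (hd.mono hsub) fun y hy => hM y (hsub hy)) e
  refine continuousAt_of_locally_lipschitz (r := ρ / 2 / 2) (by positivity)
    (4 * (2 * M / (ρ / 2)) / (ρ / 2)) fun x hx => ?_
  rw [dist_eq_norm]
  refine ContinuousLinearMap.opNorm_le_bound _ (by positivity) fun e => ?_
  calc ‖(fderiv ℂ Φ x - fderiv ℂ Φ a) e‖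
      ≤ 4 * (2 * M / (ρ / 2) * ‖e‖) / (ρ / 2) * dist x a :=
        norm_fderiv_apply_sub_le (hd.mono (ball_subset_ball (by linarith))) (hbound e) hx
    _ = 4 * (2 * M / (ρ / 2)) / (ρ / 2) * dist x a * ‖e‖ := by ring

end Holomorphic

section BoundaryDistance

variable {E : Type*} [NormedAddCommGroup E] {Ω : Set E} {x : E}

theorem infDist_frontier_pos (hΩ : IsOpen Ω) (hF : (frontier Ω).Nonempty) (hx : x ∈ Ω) :
    0 < infDist x (frontier Ω) := by
  rw [← infDist_pos_iff_notMem_closure hF, isClosed_frontier.closure_eq, hΩ.frontier_eq]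
  exact fun h => h.2 hx

theorem ball_infDist_frontier_subset [NormedSpace ℝ E] (hΩ : IsOpen Ω) (hx : x ∈ Ω) :
    ball x (infDist x (frontier Ω)) ⊆ Ω := by
  rcases (infDist_nonneg (x := x) (s := frontier Ω)).eq_or_lt with h₀ | hpos
  · simp [← h₀]
  refine (convex_ball x _).isPreconnected.subset_of_closure_inter_subset hΩ
    ⟨x, mem_ball_self hpos, hx⟩ fun y hy => ?_
  by_contra hyΩ
  have hyF : y ∈ frontier Ω := hΩ.frontier_eq ▸ ⟨hy.1, hyΩ⟩
  exact disjoint_left.1 disjoint_ball_infDist hy.2 hyF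

theorem infDist_sub_norm_sub_le (s : Set E) (x y : E) :
    infDist x s - ‖x - y‖ ≤ infDist y s := by
  have := infDist_le_infDist_add_dist (x := x) (y := y) (s := s)
  rw [dist_eq_norm] at this
  linarith

end BoundaryDistance

/-! ### Hardy–Littlewood lemmas along an inward field -/

theorem mul_rpow_add_le_mul_rpow {t T p A B : ℝ} (ht : 0 < t) (htT : t ≤ T) (hp : p ≤ 0)
    (hB : 0 ≤ B) : A * t ^ p + B ≤ (A + B / T ^ p) * t ^ p := by
  have hT : 0 < T ^ p := Real.rpow_pos_of_pos (ht.trans_le htT) p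
  have hTt : T ^ p ≤ t ^ p := Real.rpow_le_rpow_of_nonpos ht htT hp
  calc A * t ^ p + B = A * t ^ p + B / T ^ p * T ^ p := by field_simp
    _ ≤ A * t ^ p + B / T ^ p * t ^ p := by gcongr
    _ = (A + B / T ^ p) * t ^ p := by ring

theorem norm_sub_le_of_norm_deriv_le_rpow {F : Type*} [NormedAddCommGroup F] [NormedSpace ℝ F]
    {g g' : ℝ → F} {a p B T : ℝ} (ha : 0 < a) (hp : p ≠ 0) (hT : 0 ≤ T)
    (hg : ∀ s ∈ Icc 0 T, HasDerivAt g (g' s) s)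
    (hB : ∀ s ∈ Icc 0 T, ‖g' s‖ ≤ B * (s + a) ^ (p - 1)) :
    ‖g T - g 0‖ ≤ B / p * ((T + a) ^ p - a ^ p) := by
  have hbound : ∀ s ∈ Icc 0 T, HasDerivAt (fun s => B / p * ((s + a) ^ p - a ^ p))
      (B * (s + a) ^ (p - 1)) s := fun s hs => by
    have hne : s + a ≠ 0 := by linarith [hs.1]
    have h := ((((hasDerivAt_id s).add_const a).rpow_const (Or.inl hne) (p := p)).sub_const
      (a ^ p)).const_mul (B / p)
    exact h.congr_deriv (by simp only [id_eq, one_mul]; field_simp)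
  refine image_norm_le_of_norm_deriv_right_le_deriv_boundary' (f := fun s => g s - g 0) (f' := g')
    (fun s hs => ((hg s hs).sub_const _).continuousAt.continuousWithinAt)
    (fun s hs => ((hg s (Ico_subset_Icc_self hs)).sub_const _).hasDerivWithinAt)
    (by simp) (fun s hs => (hbound s hs).continuousAt.continuousWithinAt)
    (fun s hs => (hbound s (Ico_subset_Icc_self hs)).hasDerivWithinAt)
    (fun s hs => hB s (Ico_subset_Icc_self hs)) (right_mem_Icc.2 hT)

theorem norm_fderiv_le_div_infDist {E F : Type*} [NormedAddCommGroup E] [NormedSpace ℂ E]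
    [NormedAddCommGroup F] [NormedSpace ℂ F] {Φ : E → F} {Ω : Set E} {M : ℝ} {z : E}
    (hΩ : IsOpen Ω) (hd : DifferentiableOn ℂ Φ Ω) (hM : ∀ z ∈ Ω, ‖Φ z‖ ≤ M) (hz : z ∈ Ω)
    (hpos : 0 < infDist z (frontier Ω)) :
    ‖fderiv ℂ Φ z‖ ≤ 2 * M / infDist z (frontier Ω) :=
  have hsub := ball_infDist_frontier_subset hΩ hz
  norm_fderiv_le_of_norm_le hpos (hd.mono hsub) fun x hx => hM x (hsub hx)

theorem norm_sub_le_rpow_of_two_mul_le {E F : Type*} [NormedAddCommGroup E] [NormedSpace ℝ E]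
    [NormedAddCommGroup F] [NormedSpace ℝ F] {f : E → F} {Ω : Set E} {C β : ℝ} (hΩ : IsOpen Ω)
    (hd : DifferentiableOn ℝ f Ω) (hβ : β ≤ 1) (hC₀ : 0 ≤ C)
    (hC : ∀ z ∈ Ω, ‖fderiv ℝ f z‖ ≤ C * infDist z (frontier Ω) ^ (β - 1)) {z w : E}
    (hz : z ∈ Ω) (hzw : 2 * ‖w - z‖ ≤ infDist z (frontier Ω)) :
    ‖f w - f z‖ ≤ C * ‖w - z‖ ^ β := by
  rcases eq_or_ne w z with rfl | hne
  · simpa using mul_nonneg hC₀ (Real.rpow_nonneg le_rfl β)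
  have hη : 0 < ‖w - z‖ := norm_pos_iff.2 (sub_ne_zero.2 hne)
  have hsub : closedBall z ‖w - z‖ ⊆ Ω :=
    (closedBall_subset_ball (by linarith)).trans (ball_infDist_frontier_subset hΩ hz)
  have hbound : ∀ y ∈ closedBall z ‖w - z‖, ‖fderiv ℝ f y‖ ≤ C * ‖w - z‖ ^ (β - 1) := fun y hy => by
    have hy' : ‖w - z‖ ≤ infDist y (frontier Ω) := by
      linarith [mem_closedBall_iff_norm'.1 hy, infDist_sub_norm_sub_le (frontier Ω) z y]
    refine (hC y (hsub hy)).trans ?_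
    gcongr ?_ * ?_
    exact Real.rpow_le_rpow_of_nonpos hη hy' (by linarith)
  calc ‖f w - f z‖ ≤ C * ‖w - z‖ ^ (β - 1) * ‖w - z‖ :=
        (convex_closedBall z _).norm_image_sub_le_of_norm_fderiv_le
          (fun y hy => hd.differentiableAt (hΩ.mem_nhds (hsub hy))) hbound
          (mem_closedBall_self hη.le) (mem_closedBall_iff_norm.2 le_rfl)
    _ = C * ‖w - z‖ ^ β := by rw [mul_assoc, ← Real.rpow_add_one hη.ne', sub_add_cancel]

theorem norm_add_smul_sub_add_smul_le {E : Type*} [NormedAddCommGroup E] [NormedSpace ℝ E]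
    {V : E → E} {K : ℝ≥0} (hV : LipschitzWith K V) {s : ℝ} (hs : 0 ≤ s) (z w : E) :
    ‖z + s • V z - (w + s • V w)‖ ≤ (1 + K * s) * ‖z - w‖ := by
  calc ‖z + s • V z - (w + s • V w)‖ = ‖(z - w) + s • (V z - V w)‖ := by
        rw [smul_sub]; congr 1; abel
    _ ≤ ‖z - w‖ + s * (K * ‖z - w‖) := by
        refine (norm_add_le _ _).trans ?_
        rw [norm_smul, Real.norm_of_nonneg hs]
        gcongr
        exact hV.norm_sub_le z w
    _ = (1 + K * s) * ‖z - w‖ := by ring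

/-- A bounded Lipschitz vector field `V` along which points of `Ω` closer than `ε` to the boundary
move away from it at unit order speed: this is the transversality to the boundary that the
Hardy–Littlewood integration needs. -/
structure IsInwardField {E : Type*} [NormedAddCommGroup E] [NormedSpace ℝ E]
    (Ω : Set E) (V : E → E) (L K : ℝ≥0) (ε c : ℝ) : Prop where
  norm_le : ∀ z, ‖V z‖ ≤ L
  lipschitzWith : LipschitzWith K V
  ε_pos : 0 < ε
  c_pos : 0 < c
  add_smul_mem : ∀ z ∈ Ω, infDist z (frontier Ω) < ε → ∀ s ∈ Icc 0 ε, z + s • V z ∈ Ω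
  le_infDist : ∀ z ∈ Ω, infDist z (frontier Ω) < ε → ∀ s ∈ Icc 0 ε,
    c * (s + infDist z (frontier Ω)) ≤ infDist (z + s • V z) (frontier Ω)

namespace IsInwardField

variable {E : Type*} [NormedAddCommGroup E] {Ω : Set E} {V : E → E} {L K : ℝ≥0} {ε c : ℝ}

theorem infDist_pos [NormedSpace ℝ E] (h : IsInwardField Ω V L K ε c) (hΩ : IsOpen Ω) {z : E}
    (hz : z ∈ Ω) : 0 < infDist z (frontier Ω) := by
  refine infDist_frontier_pos hΩ (nonempty_iff_ne_empty.2 fun hF => ?_) hz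
  have := h.le_infDist z hz (by simpa [hF] using h.ε_pos) ε ⟨h.ε_pos.le, le_rfl⟩
  simp only [hF, infDist_empty, add_zero] at this
  exact this.not_gt (mul_pos h.c_pos h.ε_pos)

section Holomorphic

variable [NormedSpace ℂ E] {F : Type*} [NormedAddCommGroup F] [NormedSpace ℂ F]
  {Φ : E → F} {M C β : ℝ}

theorem le_infDist_of_mem_ball (h : IsInwardField Ω V L K ε c) {z y : E} {s : ℝ} (hz : z ∈ Ω)
    (hzε : infDist z (frontier Ω) < ε) (hs : s ∈ Icc 0 ε)
    (hy : y ∈ ball (z + s • V z) (c / 2 * (s + infDist z (frontier Ω)))) :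
    c / 2 * (s + infDist z (frontier Ω)) ≤ infDist y (frontier Ω) := by
  have h₁ := h.le_infDist z hz hzε s hs
  have h₂ := infDist_sub_norm_sub_le (frontier Ω) (z + s • V z) y
  rw [norm_sub_rev] at h₂
  linarith [mem_ball_iff_norm.1 hy]

theorem ball_subset (h : IsInwardField Ω V L K ε c) (hΩ : IsOpen Ω) {z : E} {s : ℝ} (hz : z ∈ Ω)
    (hzε : infDist z (frontier Ω) < ε) (hs : s ∈ Icc 0 ε) :
    ball (z + s • V z) (c / 2 * (s + infDist z (frontier Ω))) ⊆ Ω := by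
  refine (ball_subset_ball ?_).trans
    (ball_infDist_frontier_subset hΩ (h.add_smul_mem z hz hzε s hs))
  have := h.le_infDist z hz hzε s hs
  have : 0 ≤ c * (s + infDist z (frontier Ω)) :=
    mul_nonneg h.c_pos.le (add_nonneg hs.1 infDist_nonneg)
  linarith

theorem norm_sub_le_of_mem_ball (h : IsInwardField Ω V L K ε c) {z y : E} {s : ℝ} (hs : 0 ≤ s)
    (hy : y ∈ ball (z + s • V z) (c / 2 * (s + infDist z (frontier Ω)))) :
    ‖z - y‖ ≤ (L + c / 2) * (s + infDist z (frontier Ω)) := by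
  calc ‖z - y‖ = ‖(z + s • V z - y) - s • V z‖ := by congr 1; abel
    _ ≤ ‖z + s • V z - y‖ + ‖s • V z‖ := norm_sub_le _ _
    _ ≤ c / 2 * (s + infDist z (frontier Ω)) + (s + infDist z (frontier Ω)) * L := by
        rw [norm_smul, Real.norm_of_nonneg hs]
        gcongr
        · exact (mem_ball_iff_norm'.1 hy).le
        · exact add_nonneg hs infDist_nonneg
        · exact le_add_of_nonneg_right infDist_nonneg
        · exact h.norm_le z
    _ = (L + c / 2) * (s + infDist z (frontier Ω)) := by ring

theorem exists_norm_fderiv_apply_le (h : IsInwardField Ω V L K ε c) (hΩ : IsOpen Ω)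
    (hd : DifferentiableOn ℂ Φ Ω) (hM : ∀ z ∈ Ω, ‖Φ z‖ ≤ M) (hβ : β ≤ 1)
    (hC : ∀ z ∈ Ω, ‖fderiv ℂ Φ z (V z)‖ ≤ C * infDist z (frontier Ω) ^ (β - 1)) :
    ∃ C', ∀ z ∈ Ω, infDist z (frontier Ω) < ε → ∀ s ∈ Icc 0 ε,
      ∀ y ∈ ball (z + s • V z) (c / 2 * (s + infDist z (frontier Ω))),
        ‖fderiv ℂ Φ y (V z)‖ ≤ C' * (s + infDist z (frontier Ω)) ^ (β - 1) := by
  have hc : 0 < c / 2 := half_pos h.c_pos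
  set B : ℝ := 2 * M / (c / 2) * (K * (L + c / 2))
  refine ⟨C * (c / 2) ^ (β - 1) + B / (ε + ε) ^ (β - 1), fun z hz hzε s hs y hy => ?_⟩
  have hM₀ : 0 ≤ M := (norm_nonneg _).trans (hM z hz)
  have hpos := h.infDist_pos hΩ hz
  have hC₀ : 0 ≤ C :=
    (mul_nonneg_iff_of_pos_right (by positivity)).1 ((norm_nonneg _).trans (hC z hz))
  have hδ : 0 < s + infDist z (frontier Ω) := add_pos_of_nonneg_of_pos hs.1 hpos
  have hδy := h.le_infDist_of_mem_ball hz hzε hs hy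
  have hyΩ := h.ball_subset hΩ hz hzε hs hy
  have hzy := h.norm_sub_le_of_mem_ball hs.1 hy
  set δ := s + infDist z (frontier Ω)
  have hown : ‖fderiv ℂ Φ y (V y)‖ ≤ C * (c / 2) ^ (β - 1) * δ ^ (β - 1) := by
    calc ‖fderiv ℂ Φ y (V y)‖ ≤ C * (c / 2 * δ) ^ (β - 1) := (hC y hyΩ).trans <| by
          gcongr ?_ * ?_
          exact Real.rpow_le_rpow_of_nonpos (by positivity) hδy (by linarith)
      _ = C * (c / 2) ^ (β - 1) * δ ^ (β - 1) := by
          rw [Real.mul_rpow hc.le hδ.le, mul_assoc]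
  have hvar : ‖fderiv ℂ Φ y (V z - V y)‖ ≤ B := by
    calc ‖fderiv ℂ Φ y (V z - V y)‖ ≤ 2 * M / infDist y (frontier Ω) * (K * ‖z - y‖) :=
          (fderiv ℂ Φ y).le_of_opNorm_le_of_le
            (norm_fderiv_le_div_infDist hΩ hd hM hyΩ (h.infDist_pos hΩ hyΩ))
            (h.lipschitzWith.norm_sub_le z y)
      _ ≤ 2 * M / (c / 2 * δ) * (K * ((L + c / 2) * δ)) := by gcongr
      _ = B := by simp only [B]; field_simp
  calc ‖fderiv ℂ Φ y (V z)‖ = ‖fderiv ℂ Φ y (V y) + fderiv ℂ Φ y (V z - V y)‖ := by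
        rw [← map_add, add_sub_cancel]
    _ ≤ C * (c / 2) ^ (β - 1) * δ ^ (β - 1) + B :=
        (norm_add_le _ _).trans (add_le_add hown hvar)
    _ ≤ _ := mul_rpow_add_le_mul_rpow hδ (by linarith [hs.2]) (by linarith) (by positivity)

theorem add_smul_mem_ball (h : IsInwardField Ω V L K ε c) {z w : E} {s : ℝ} (hs : 0 ≤ s)
    (hw : w ∈ ball z (c / 4 * infDist z (frontier Ω))) :
    w + s • V z ∈ ball (z + s • V z) (c / 2 * (s + infDist z (frontier Ω)) / 2) := by
  rw [mem_ball_iff_norm, add_sub_add_right_eq_sub]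
  nlinarith [mem_ball_iff_norm.1 hw, h.c_pos]

theorem norm_fderiv_apply_sub_le_rpow (h : IsInwardField Ω V L K ε c) (hΩ : IsOpen Ω)
    (hd : DifferentiableOn ℂ Φ Ω) {z w : E} (hz : z ∈ Ω) (hzε : infDist z (frontier Ω) < ε)
    {s : ℝ} (hs : s ∈ Icc 0 ε)
    (hC : ∀ y ∈ ball (z + s • V z) (c / 2 * (s + infDist z (frontier Ω))),
      ‖fderiv ℂ Φ y (V z)‖ ≤ C * (s + infDist z (frontier Ω)) ^ (β - 1))
    (hw : w ∈ ball z (c / 4 * infDist z (frontier Ω))) :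
    ‖fderiv ℂ Φ (w + s • V z) (V z) - fderiv ℂ Φ (z + s • V z) (V z)‖ ≤
      8 * C / c * ‖w - z‖ * (s + infDist z (frontier Ω)) ^ (β - 1 - 1) := by
  have hc := h.c_pos
  have hδ : 0 < s + infDist z (frontier Ω) := add_pos_of_nonneg_of_pos hs.1 (h.infDist_pos hΩ hz)
  refine (norm_fderiv_apply_sub_le (hd.mono (h.ball_subset hΩ hz hzε hs)) hC
    (h.add_smul_mem_ball hs.1 hw)).trans_eq ?_
  rw [dist_add_right, dist_eq_norm, Real.rpow_sub_one hδ.ne' (β - 1)]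
  field_simp
  ring

theorem nonneg_of_norm_fderiv_apply_le (h : IsInwardField Ω V L K ε c) (hΩ : IsOpen Ω) {z : E}
    (hz : z ∈ Ω)
    (hC : ∀ s ∈ Icc 0 ε, ∀ y ∈ ball (z + s • V z) (c / 2 * (s + infDist z (frontier Ω))),
      ‖fderiv ℂ Φ y (V z)‖ ≤ C * (s + infDist z (frontier Ω)) ^ (β - 1)) : 0 ≤ C := by
  have hc := h.c_pos
  have hpos := h.infDist_pos hΩ hz
  have hz₀ : z ∈ ball (z + (0 : ℝ) • V z) (c / 2 * (0 + infDist z (frontier Ω))) := by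
    rw [zero_smul, add_zero]
    exact mem_ball_self (by positivity)
  exact (mul_nonneg_iff_of_pos_right (by positivity)).1
    ((norm_nonneg _).trans (hC 0 (left_mem_Icc.2 h.ε_pos.le) z hz₀))

/-- The mixed derivative bound is integrated along the inward segments through `z` and `w`. -/
theorem norm_sub_sub_le_rpow (h : IsInwardField Ω V L K ε c) (hΩ : IsOpen Ω)
    (hd : DifferentiableOn ℂ Φ Ω) (hβ : β < 1) {z w : E} (hz : z ∈ Ω)
    (hzε : infDist z (frontier Ω) < ε)
    (hC : ∀ s ∈ Icc 0 ε, ∀ y ∈ ball (z + s • V z) (c / 2 * (s + infDist z (frontier Ω))),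
      ‖fderiv ℂ Φ y (V z)‖ ≤ C * (s + infDist z (frontier Ω)) ^ (β - 1))
    (hw : w ∈ ball z (c / 4 * infDist z (frontier Ω))) :
    ‖Φ (w + ε • V z) - Φ (z + ε • V z) - (Φ w - Φ z)‖ ≤
      8 * C / (c * (1 - β)) * infDist z (frontier Ω) ^ (β - 1) * ‖w - z‖ := by
  have hc := h.c_pos
  have hε := h.ε_pos
  have hβ' : 0 < 1 - β := by linarith
  have hpos := h.infDist_pos hΩ hz
  have hC₀ := h.nonneg_of_norm_fderiv_apply_le hΩ hz hC
  have hderiv : ∀ s ∈ Icc 0 ε, ∀ y ∈ ball (z + s • V z) (c / 2 * (s + infDist z (frontier Ω)) / 2),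
      HasFDerivAt Φ ((fderiv ℂ Φ y).restrictScalars ℝ) y := fun s hs y hy =>
    have hyΩ := h.ball_subset hΩ hz hzε hs (ball_subset_ball (half_le_self
      (mul_nonneg (half_pos hc).le (add_nonneg hs.1 hpos.le))) hy)
    (hd.differentiableAt (hΩ.mem_nhds hyΩ)).hasFDerivAt.restrictScalars ℝ
  have hgrowth := norm_sub_le_of_norm_deriv_le_rpow (p := β - 1)
    (g := fun s => Φ (w + s • V z) - Φ (z + s • V z)) hpos (by linarith) hε.le
    (fun s hs => (hasDerivAt_comp_add_smul (hderiv s hs _ (h.add_smul_mem_ball hs.1 hw))).sub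
      (hasDerivAt_comp_add_smul (hderiv s hs _
        (h.add_smul_mem_ball hs.1 (mem_ball_self (by positivity))))))
    (fun s hs => h.norm_fderiv_apply_sub_le_rpow hΩ hd hz hzε hs (hC s hs) hw)
  simp only [zero_smul, add_zero] at hgrowth
  calc _ ≤ 8 * C / c * ‖w - z‖ / (β - 1) *
        ((ε + infDist z (frontier Ω)) ^ (β - 1) - infDist z (frontier Ω) ^ (β - 1)) := hgrowth
    _ = 8 * C / (c * (1 - β)) * ‖w - z‖ *
        (infDist z (frontier Ω) ^ (β - 1) - (ε + infDist z (frontier Ω)) ^ (β - 1)) := by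
      rw [← neg_sub 1 β]
      field_simp
      ring
    _ ≤ 8 * C / (c * (1 - β)) * ‖w - z‖ * infDist z (frontier Ω) ^ (β - 1) := by
      gcongr
      exact sub_le_self _ (by positivity)
    _ = _ := by ring

theorem norm_add_smul_sub_le (h : IsInwardField Ω V L K ε c) (hΩ : IsOpen Ω)
    (hd : DifferentiableOn ℂ Φ Ω) (hM : ∀ z ∈ Ω, ‖Φ z‖ ≤ M) {z w : E} (hz : z ∈ Ω)
    (hzε : infDist z (frontier Ω) < ε) (hw : w ∈ ball z (c / 4 * infDist z (frontier Ω))) :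
    ‖Φ (w + ε • V z) - Φ (z + ε • V z)‖ ≤ 4 * M / (c * ε) * ‖w - z‖ := by
  have hc := h.c_pos
  have hε := h.ε_pos
  have hM₀ : 0 ≤ M := (norm_nonneg _).trans (hM z hz)
  have hpos := h.infDist_pos hΩ hz
  have hsub := h.ball_subset hΩ hz hzε (right_mem_Icc.2 hε.le)
  have hwz : ‖w - z‖ < c / 2 * (ε + infDist z (frontier Ω)) := by
    nlinarith [mem_ball_iff_norm.1 hw]
  calc ‖Φ (w + ε • V z) - Φ (z + ε • V z)‖ = ‖Φ (z + ε • V z + (w - z)) - Φ (z + ε • V z)‖ := by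
        congr 3; abel
    _ ≤ 2 * M / (c / 2 * (ε + infDist z (frontier Ω))) * ‖w - z‖ :=
        norm_add_sub_le_of_norm_le (hd.mono hsub) (fun y hy => hM y (hsub hy)) hwz
    _ ≤ 2 * M / (c / 2 * ε) * ‖w - z‖ := by gcongr; linarith
    _ = 4 * M / (c * ε) * ‖w - z‖ := by field_simp; ring

theorem exists_norm_fderiv_le_rpow (h : IsInwardField Ω V L K ε c) (hΩ : IsOpen Ω)
    (hd : DifferentiableOn ℂ Φ Ω) (hM : ∀ z ∈ Ω, ‖Φ z‖ ≤ M) (hβ₀ : 0 ≤ β) (hβ₁ : β < 1)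
    (hC : ∀ z ∈ Ω, ‖fderiv ℂ Φ z (V z)‖ ≤ C * infDist z (frontier Ω) ^ (β - 1)) :
    ∃ C', ∀ z ∈ Ω, ‖fderiv ℂ Φ z‖ ≤ C' * infDist z (frontier Ω) ^ (β - 1) := by
  obtain ⟨B, hB⟩ := h.exists_norm_fderiv_apply_le hΩ hd hM hβ₁.le hC
  have hc := h.c_pos
  have hε := h.ε_pos
  set A := 8 * B / (c * (1 - β))
  refine ⟨max (A + 4 * M / (c * ε) / ε ^ (β - 1)) (2 * M / ε ^ β), fun z hz => ?_⟩
  have hM₀ : 0 ≤ M := (norm_nonneg _).trans (hM z hz)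
  have hpos := h.infDist_pos hΩ hz
  rcases lt_or_ge (infDist z (frontier Ω)) ε with hzε | hzε
  · have hlip : ∀ᶠ w in 𝓝 z,
        ‖Φ w - Φ z‖ ≤ (A * infDist z (frontier Ω) ^ (β - 1) + 4 * M / (c * ε)) * ‖w - z‖ := by
      filter_upwards [ball_mem_nhds z (show 0 < c / 4 * infDist z (frontier Ω) by positivity)]
        with w hw
      have hpush := h.norm_add_smul_sub_le hΩ hd hM hz hzε hw
      have hdiff := h.norm_sub_sub_le_rpow hΩ hd hβ₁ hz hzε (hB z hz hzε) hw
      linarith [norm_sub_norm_le (Φ w - Φ z) (Φ (w + ε • V z) - Φ (z + ε • V z)),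
        norm_sub_rev (Φ w - Φ z) (Φ (w + ε • V z) - Φ (z + ε • V z))]
    have hB₀ : 0 ≤ B := h.nonneg_of_norm_fderiv_apply_le hΩ hz (hB z hz hzε)
    have : 0 ≤ A := div_nonneg (by positivity) (mul_nonneg hc.le (by linarith))
    calc ‖fderiv ℂ Φ z‖ ≤ A * infDist z (frontier Ω) ^ (β - 1) + 4 * M / (c * ε) :=
          (hd.differentiableAt (hΩ.mem_nhds hz)).hasFDerivAt.le_of_lip' (by positivity) hlip
      _ ≤ (A + 4 * M / (c * ε) / ε ^ (β - 1)) * infDist z (frontier Ω) ^ (β - 1) :=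
          mul_rpow_add_le_mul_rpow hpos hzε.le (by linarith) (by positivity)
      _ ≤ _ := by gcongr; exact le_max_left _ _
  · calc ‖fderiv ℂ Φ z‖ ≤ 2 * M / infDist z (frontier Ω) :=
          norm_fderiv_le_div_infDist hΩ hd hM hz hpos
      _ = 2 * M / infDist z (frontier Ω) ^ β * infDist z (frontier Ω) ^ (β - 1) := by
          rw [Real.rpow_sub_one hpos.ne']
          field_simp
      _ ≤ 2 * M / ε ^ β * infDist z (frontier Ω) ^ (β - 1) := by gcongr
      _ ≤ _ := by gcongr; exact le_max_right _ _

end Holomorphic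

section Real

variable [NormedSpace ℝ E] {F : Type*} [NormedAddCommGroup F] [NormedSpace ℝ F]
  {f : E → F} {M C β : ℝ}

theorem norm_add_smul_sub_le_rpow (h : IsInwardField Ω V L K ε c) (hΩ : IsOpen Ω)
    (hd : DifferentiableOn ℝ f Ω) (hβ₀ : 0 < β) (hβ₁ : β ≤ 1)
    (hC : ∀ z ∈ Ω, ‖fderiv ℝ f z‖ ≤ C * infDist z (frontier Ω) ^ (β - 1)) {z : E}
    (hz : z ∈ Ω) (hzε : infDist z (frontier Ω) < ε) {T : ℝ} (hT : T ∈ Icc 0 ε) :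
    ‖f (z + T • V z) - f z‖ ≤ C * c ^ (β - 1) * L / β * T ^ β := by
  have hc := h.c_pos
  have hpos := h.infDist_pos hΩ hz
  have hC₀ : 0 ≤ C :=
    (mul_nonneg_iff_of_pos_right (by positivity)).1 ((norm_nonneg _).trans (hC z hz))
  have hmem : ∀ s ∈ Icc 0 T, s ∈ Icc 0 ε := fun s hs => ⟨hs.1, hs.2.trans hT.2⟩
  have hderiv : ∀ s ∈ Icc 0 T, HasDerivAt (fun s => f (z + s • V z))
      (fderiv ℝ f (z + s • V z) (V z)) s := fun s hs =>
    hasDerivAt_comp_add_smul (hd.differentiableAt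
      (hΩ.mem_nhds (h.add_smul_mem z hz hzε s (hmem s hs)))).hasFDerivAt
  have hbound : ∀ s ∈ Icc 0 T, ‖fderiv ℝ f (z + s • V z) (V z)‖ ≤
      C * c ^ (β - 1) * L * (s + infDist z (frontier Ω)) ^ (β - 1) := fun s hs => by
    have hδ : 0 < s + infDist z (frontier Ω) := add_pos_of_nonneg_of_pos hs.1 hpos
    calc ‖fderiv ℝ f (z + s • V z) (V z)‖
        ≤ C * infDist (z + s • V z) (frontier Ω) ^ (β - 1) * L :=
          (fderiv ℝ f _).le_of_opNorm_le_of_le (hC _ (h.add_smul_mem z hz hzε s (hmem s hs)))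
            (h.norm_le z)
      _ ≤ C * (c * (s + infDist z (frontier Ω))) ^ (β - 1) * L := by
          gcongr ?_ * ?_ * _
          exact Real.rpow_le_rpow_of_nonpos (by positivity)
            (h.le_infDist z hz hzε s (hmem s hs)) (by linarith)
      _ = C * c ^ (β - 1) * L * (s + infDist z (frontier Ω)) ^ (β - 1) := by
          rw [Real.mul_rpow hc.le hδ.le]
          ring
  have hgrowth := norm_sub_le_of_norm_deriv_le_rpow hpos hβ₀.ne' hT.1 hderiv hbound
  rw [zero_smul, add_zero] at hgrowth
  refine hgrowth.trans ?_
  gcongr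
  linarith [Real.rpow_add_le_add_rpow hT.1 hpos.le hβ₀.le hβ₁]

/-- Both points are pushed inward by a multiple of their distance. -/
theorem norm_sub_le_rpow_of_infDist_lt (h : IsInwardField Ω V L K ε c) (hΩ : IsOpen Ω)
    (hd : DifferentiableOn ℝ f Ω) (hβ₀ : 0 < β) (hβ₁ : β ≤ 1)
    (hC : ∀ z ∈ Ω, ‖fderiv ℝ f z‖ ≤ C * infDist z (frontier Ω) ^ (β - 1)) {z w : E}
    (hz : z ∈ Ω) (hw : w ∈ Ω) (hzε : infDist z (frontier Ω) < ε) (hwε : infDist w (frontier Ω) < ε)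
    (hzw : 2 * (1 + K * ε) / c * ‖z - w‖ ≤ ε) :
    ‖f z - f w‖ ≤ (2 * (C * c ^ (β - 1) * L / β * (2 * (1 + K * ε) / c) ^ β) +
      C * (1 + K * ε) ^ β) * ‖z - w‖ ^ β := by
  have hc := h.c_pos
  have hε := h.ε_pos
  have hpos := h.infDist_pos hΩ hz
  have hC₀ : 0 ≤ C :=
    (mul_nonneg_iff_of_pos_right (by positivity)).1 ((norm_nonneg _).trans (hC z hz))
  set T := 2 * (1 + K * ε) / c * ‖z - w‖ with hT_def
  have hT : T ∈ Icc 0 ε := ⟨by positivity, hzw⟩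
  have hpush : ‖w + T • V w - (z + T • V z)‖ ≤ (1 + K * ε) * ‖z - w‖ := by
    rw [norm_sub_rev z]
    refine (norm_add_smul_sub_add_smul_le h.lipschitzWith hT.1 w z).trans ?_
    gcongr
  have hdepth : 2 * ‖w + T • V w - (z + T • V z)‖ ≤ infDist (z + T • V z) (frontier Ω) := by
    calc 2 * ‖w + T • V w - (z + T • V z)‖ ≤ c * T := by
          rw [hT_def, ← mul_assoc, mul_div_cancel₀ _ hc.ne']
          linarith
      _ ≤ c * (T + infDist z (frontier Ω)) := by gcongr; linarith
      _ ≤ _ := h.le_infDist z hz hzε T hT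
  have hzT := h.norm_add_smul_sub_le_rpow hΩ hd hβ₀ hβ₁ hC hz hzε hT
  have hwT := h.norm_add_smul_sub_le_rpow hΩ hd hβ₀ hβ₁ hC hw hwε hT
  have hmid : ‖f (w + T • V w) - f (z + T • V z)‖ ≤ C * (1 + K * ε) ^ β * ‖z - w‖ ^ β := by
    refine (norm_sub_le_rpow_of_two_mul_le hΩ hd hβ₁ hC₀ hC (h.add_smul_mem z hz hzε T hT)
      hdepth).trans ?_
    rw [mul_assoc, ← Real.mul_rpow (by positivity) (norm_nonneg _)]
    gcongr
  rw [hT_def, Real.mul_rpow (by positivity) (norm_nonneg _), ← hT_def] at hzT hwT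
  have htri := norm_sub_le_norm_sub_add_norm_sub (f z) (f (z + T • V z)) (f w)
  have htri' := norm_sub_le_norm_sub_add_norm_sub (f (z + T • V z)) (f (w + T • V w)) (f w)
  rw [norm_sub_rev] at hzT hmid
  linarith

theorem exists_norm_sub_le_rpow (h : IsInwardField Ω V L K ε c) (hΩ : IsOpen Ω)
    (hd : DifferentiableOn ℝ f Ω) (hM : ∀ z ∈ Ω, ‖f z‖ ≤ M) (hβ₀ : 0 < β) (hβ₁ : β ≤ 1)
    (hC : ∀ z ∈ Ω, ‖fderiv ℝ f z‖ ≤ C * infDist z (frontier Ω) ^ (β - 1)) :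
    ∃ C', ∀ z ∈ Ω, ∀ w ∈ Ω, ‖f z - f w‖ ≤ C' * ‖z - w‖ ^ β := by
  have hc := h.c_pos
  have hε := h.ε_pos
  set A := 2 * (1 + K * ε) / c
  set B := 2 * (C * c ^ (β - 1) * L / β * A ^ β) + C * (1 + K * ε) ^ β
  have : 0 < A := by positivity
  set η₀ := ε / (3 + A) with hη₀_def
  have hη₀ : 0 < η₀ := by positivity
  refine ⟨max C (max B (2 * M / η₀ ^ β)), fun z hz w hw => ?_⟩
  rcases le_or_gt (2 * ‖w - z‖) (infDist z (frontier Ω)) with hfar | hnear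
  · have hpos := h.infDist_pos hΩ hz
    have hC₀ : 0 ≤ C :=
      (mul_nonneg_iff_of_pos_right (by positivity)).1 ((norm_nonneg _).trans (hC z hz))
    rw [norm_sub_rev, norm_sub_rev z]
    refine (norm_sub_le_rpow_of_two_mul_le hΩ hd hβ₁ hC₀ hC hz hfar).trans ?_
    gcongr
    exact le_max_left _ _
  rw [norm_sub_rev] at hnear
  rcases lt_or_ge ‖z - w‖ η₀ with hη | hη
  · have hη' : (3 + A) * ‖z - w‖ < ε := by rwa [hη₀_def, lt_div_iff₀' (by positivity)] at hη
    have hAη : 0 ≤ A * ‖z - w‖ := by positivity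
    have hwz := infDist_sub_norm_sub_le (frontier Ω) w z
    rw [norm_sub_rev] at hwz
    refine (h.norm_sub_le_rpow_of_infDist_lt hΩ hd hβ₀ hβ₁ hC hz hw
      (by linarith [norm_nonneg (z - w)]) (by linarith)
      (by linarith [norm_nonneg (z - w)])).trans ?_
    gcongr
    exact (le_max_left _ _).trans (le_max_right _ _)
  · have hM₀ : 0 ≤ M := (norm_nonneg _).trans (hM z hz)
    calc ‖f z - f w‖ ≤ 2 * M := by linarith [norm_sub_le (f z) (f w), hM z hz, hM w hw]
      _ = 2 * M / η₀ ^ β * η₀ ^ β := by field_simp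
      _ ≤ 2 * M / η₀ ^ β * ‖z - w‖ ^ β := by gcongr
      _ ≤ _ := by gcongr; exact (le_max_right _ _).trans (le_max_right _ _)

end Real

end IsInwardField

/-! ### Defining functions and the distance to the boundary -/

section Gradient

variable {E : Type*} [NormedAddCommGroup E] [InnerProductSpace ℝ E] [CompleteSpace E]
  {f g : E → ℝ} {q x y : E}

theorem norm_gradient_sub_gradient : ‖∇ f x - ∇ g y‖ = ‖fderiv ℝ f x - fderiv ℝ g y‖ := by
  rw [gradient, gradient, ← map_sub, LinearIsometryEquiv.norm_map]

theorem norm_gradient : ‖∇ f x‖ = ‖fderiv ℝ f x‖ :=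
  LinearIsometryEquiv.norm_map _ _

theorem norm_smul_gradient_eq_of_isMaxOn_closedBall (hf : DifferentiableAt ℝ f y)
    (hmax : IsMaxOn f (closedBall q ‖y - q‖) y) : ‖y - q‖ • ∇ f y = ‖∇ f y‖ • (y - q) := by
  rcases eq_or_ne (∇ f y) 0 with h₀ | h₀
  · simp [h₀]
  have hg : 0 < ‖∇ f y‖ := norm_pos_iff.2 h₀
  set x := q + (‖y - q‖ / ‖∇ f y‖) • ∇ f y
  have hx : x ∈ closedBall q ‖y - q‖ := by
    rw [mem_closedBall_iff_norm, add_sub_cancel_left, norm_smul,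
      Real.norm_of_nonneg (by positivity), div_mul_cancel₀ _ hg.ne']
  have hseg : segment ℝ y x ⊆ closedBall q ‖y - q‖ :=
    (convex_closedBall q _).segment_subset (mem_closedBall_iff_norm.2 le_rfl) hx
  have hle : fderiv ℝ f y (x - y) ≤ 0 := hmax.localize.hasFDerivWithinAt_nonpos
    hf.hasFDerivAt.hasFDerivWithinAt (sub_mem_posTangentConeAt_of_segment_subset hseg)
  have hxy : x - y = (‖y - q‖ / ‖∇ f y‖) • ∇ f y - (y - q) := by simp only [x]; abel
  rw [← inner_gradient_left, hxy, inner_sub_right, inner_smul_right,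
    real_inner_self_eq_norm_mul_norm, ← mul_assoc, div_mul_cancel₀ _ hg.ne'] at hle
  exact inner_eq_norm_mul_iff_real.1
    ((real_inner_le_norm _ _).antisymm (by linarith))

theorem infDist_smul_gradient_infDist {s : Set E} (hd : DifferentiableAt ℝ (infDist · s) q)
    (hy : y ∈ s) (hqy : infDist q s = ‖q - y‖) : infDist q s • ∇ (infDist · s) q = q - y := by
  -- `‖x - y‖² - d(x, s)²` is minimal at `x = q`.
  have hmin : IsLocalMin (fun x => ‖x - y‖ ^ 2 - infDist x s ^ 2) q := .of_forall fun x => by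
    have := infDist_le_dist_of_mem (x := x) hy
    rw [dist_eq_norm] at this
    simp only [hqy, sub_self, sub_nonneg]
    gcongr
    exact infDist_nonneg
  have hderiv := ((hasFDerivAt_id q).sub_const y).norm_sq.sub (hd.hasFDerivAt.pow 2)
  refine ext_inner_right ℝ fun v => ?_
  have hv : 2 * ⟪q - y, v⟫ - 2 * infDist q s * fderiv ℝ (infDist · s) q v = 0 := by
    simpa [inner_sub_left] using DFunLike.congr_fun (hmin.hasFDerivAt_eq_zero hderiv) v
  rw [real_inner_smul_left, inner_gradient_left]
  linarith

end Gradient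

theorem abs_sub_sub_fderiv_le {E : Type*} [NormedAddCommGroup E] [NormedSpace ℝ E] {f : E → ℝ}
    {K : ℝ≥0} (hf : Differentiable ℝ f) (hK : LipschitzWith K (fderiv ℝ f)) (x y : E) :
    |f y - f x - fderiv ℝ f x (y - x)| ≤ K * ‖y - x‖ ^ 2 := by
  rw [pow_two, ← mul_assoc]
  refine (convex_closedBall x ‖y - x‖).norm_image_sub_le_of_norm_fderiv_le' (fun z _ => hf z)
    (fun z hz => ?_) (mem_closedBall_self (norm_nonneg _)) (mem_closedBall_iff_norm.2 le_rfl)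
  refine (hK.norm_sub_le z x).trans ?_
  gcongr
  exact mem_closedBall_iff_norm.1 hz

/-- `r` is a defining function of `Ω = {r < 0}`, of class `C^{1,1}` with explicit constants: `L`
bounds its first derivatives, `K` is a Lipschitz constant for them, and `m` bounds the gradient from
below on the boundary. -/
structure IsDefiningFunction {E : Type*} [NormedAddCommGroup E] [NormedSpace ℝ E] (Ω : Set E)
    (r : E → ℝ) (L K : ℝ≥0) (m : ℝ) : Prop where
  eq_setOf_neg : Ω = {z | r z < 0}
  differentiable : Differentiable ℝ r
  lipschitzWith : LipschitzWith L r
  lipschitzWith_fderiv : LipschitzWith K (fderiv ℝ r)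
  pos : 0 < m
  le_norm_fderiv : ∀ z ∈ frontier Ω, m ≤ ‖fderiv ℝ r z‖

theorem exists_isDefiningFunction {E : Type*} [NormedAddCommGroup E] [NormedSpace ℝ E]
    [FiniteDimensional ℝ E] {Ω : Set E} (hb : IsBounded Ω) {r : E → ℝ}
    (hr : ContDiff ℝ 2 r) (hΩ : Ω = {z | r z < 0}) (hdr : ∀ z ∈ frontier Ω, fderiv ℝ r z ≠ 0) :
    ∃ r' L K m, IsDefiningFunction Ω r' L K m := by
  obtain ⟨R, hR, hΩR⟩ := hb.closure.subset_ball_lt 0 0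
  let χ : ContDiffBump (0 : E) := ⟨R, R + 1, hR, lt_add_one R⟩
  set r' : E → ℝ := fun z => χ z * r z
  have hr' : ContDiff ℝ 2 r' := χ.contDiff.mul hr
  have hsupp : HasCompactSupport r' := χ.hasCompactSupport.mul_right
  have hfderiv : ∀ z ∈ frontier Ω, fderiv ℝ r' z = fderiv ℝ r z := fun z hz => by
    refine EventuallyEq.fderiv_eq ?_
    filter_upwards [χ.eventuallyEq_one_of_mem_ball (hΩR (frontier_subset_closure hz))] with w hw
    simp [r', hw]
  obtain ⟨L, hL⟩ := hr'.lipschitzWith_of_hasCompactSupport hsupp two_ne_zero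
  obtain ⟨K, hK⟩ := (hr'.fderiv_right (m := 1) le_rfl).lipschitzWith_of_hasCompactSupport
    (hsupp.fderiv ℝ) one_ne_zero
  obtain ⟨m, hm, hm'⟩ :=
    (isCompact_of_isClosed_isBounded isClosed_frontier
      (hb.closure.subset frontier_subset_closure)).exists_forall_le'
      (hr.continuous_fderiv two_ne_zero).norm.continuousOn (a := 0)
      fun z hz => norm_pos_iff.2 (hdr z hz)
  refine ⟨r', L, K, m, ?_, hr'.differentiable two_ne_zero, hL, hK, hm,
    fun z hz => (hfderiv z hz).symm ▸ hm' z hz⟩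
  ext z
  by_cases hz : z ∈ Ω
  · have hχ : χ z = 1 := χ.one_of_mem_closedBall (ball_subset_closedBall (hΩR (subset_closure hz)))
    simpa [r', hχ] using Set.ext_iff.1 hΩ z
  · have hrz : 0 ≤ r z := not_lt.1 fun h => hz (hΩ ▸ h)
    exact iff_of_false hz (mul_nonneg χ.nonneg hrz).not_gt

namespace IsDefiningFunction

section NormedSpace

variable {E : Type*} [NormedAddCommGroup E] [NormedSpace ℝ E] {Ω : Set E} {r : E → ℝ} {L K : ℝ≥0}
  {m : ℝ}

theorem isOpen (h : IsDefiningFunction Ω r L K m) : IsOpen Ω :=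
  h.eq_setOf_neg ▸ isOpen_lt h.lipschitzWith.continuous continuous_const

theorem mem_iff (h : IsDefiningFunction Ω r L K m) {z : E} : z ∈ Ω ↔ r z < 0 := by
  simp [h.eq_setOf_neg]

theorem eq_zero_of_mem_frontier (h : IsDefiningFunction Ω r L K m) {z : E} (hz : z ∈ frontier Ω) :
    r z = 0 := by
  rw [h.eq_setOf_neg] at hz
  exact frontier_lt_subset_eq h.lipschitzWith.continuous continuous_const hz

theorem neg_le_mul_infDist [ProperSpace E] (h : IsDefiningFunction Ω r L K m)
    (hF : (frontier Ω).Nonempty) (z : E) : -r z ≤ L * infDist z (frontier Ω) := by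
  obtain ⟨y, hy, hzy⟩ := isClosed_frontier.exists_infDist_eq_dist hF z
  have hlip := h.lipschitzWith.norm_sub_le z y
  rw [h.eq_zero_of_mem_frontier hy, sub_zero, ← dist_eq_norm z, ← hzy] at hlip
  exact (neg_le_abs _).trans hlip

theorem sub_mul_infDist_le_norm_fderiv [ProperSpace E] (h : IsDefiningFunction Ω r L K m)
    (hF : (frontier Ω).Nonempty) (z : E) :
    m - K * infDist z (frontier Ω) ≤ ‖fderiv ℝ r z‖ := by
  obtain ⟨y, hy, hzy⟩ := isClosed_frontier.exists_infDist_eq_dist hF z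
  have hlip := h.lipschitzWith_fderiv.norm_sub_le y z
  rw [norm_sub_rev y, ← dist_eq_norm z, ← hzy] at hlip
  linarith [h.le_norm_fderiv y hy, norm_sub_norm_le (fderiv ℝ r y) (fderiv ℝ r z)]

end NormedSpace

variable {E : Type*} [NormedAddCommGroup E] [InnerProductSpace ℝ E] [ProperSpace E] {Ω : Set E}
  {r : E → ℝ} {L K : ℝ≥0} {m : ℝ}

/-- At a point `y` of the boundary nearest to `q`, `∇ r y` is normal to the sphere
through `y` centred at `q`, hence a negative multiple of `∇ d q`. -/
theorem exists_norm_gradient_add_smul_gradient_infDist_le (h : IsDefiningFunction Ω r L K m)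
    (hF : (frontier Ω).Nonempty) {q : E} (hq : q ∈ Ω)
    (hd : DifferentiableAt ℝ (infDist · (frontier Ω)) q) :
    ∃ a ∈ Icc m L, ‖∇ r q + a • ∇ (infDist · (frontier Ω)) q‖ ≤ K * infDist q (frontier Ω) := by
  obtain ⟨y, hy, hqy⟩ := isClosed_frontier.exists_infDist_eq_dist hF q
  rw [dist_eq_norm] at hqy
  have hpos := infDist_frontier_pos h.isOpen hF hq
  have hnonpos : closedBall q ‖y - q‖ ⊆ {z | r z ≤ 0} := by
    rw [norm_sub_rev, ← hqy, ← closure_ball q hpos.ne']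
    refine closure_minimal (fun z hz => ?_)
      (isClosed_le h.lipschitzWith.continuous continuous_const)
    exact (h.mem_iff.1 (ball_infDist_frontier_subset h.isOpen hq hz)).le
  have hmax : IsMaxOn r (closedBall q ‖y - q‖) y := fun z hz =>
    (hnonpos hz).trans_eq (h.eq_zero_of_mem_frontier hy).symm
  have hnormal := norm_smul_gradient_eq_of_isMaxOn_closedBall (h.differentiable y) hmax
  rw [norm_sub_rev, ← hqy, ← neg_sub q, ← infDist_smul_gradient_infDist hd hy hqy, ← smul_neg,
    smul_comm ‖∇ r y‖] at hnormal
  have hgrad : ∇ r y = -(‖∇ r y‖ • ∇ (infDist · (frontier Ω)) q) := by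
    rw [← smul_neg]
    exact smul_right_injective E hpos.ne' hnormal
  refine ⟨‖∇ r y‖, ⟨?_, ?_⟩, ?_⟩
  · rw [norm_gradient]
    exact h.le_norm_fderiv y hy
  · rw [norm_gradient]
    exact norm_fderiv_le_of_lipschitz ℝ h.lipschitzWith
  · rw [← sub_neg_eq_add, ← hgrad, norm_gradient_sub_gradient, hqy]
    exact h.lipschitzWith_fderiv.norm_sub_le q y

theorem apply_sub_smul_gradient_le (h : IsDefiningFunction Ω r L K m) {s : ℝ} (hs : 0 ≤ s)
    (hKs : K * s ≤ 1 / 2) (z : E) : r (z + s • -∇ r z) ≤ r z - s / 2 * ‖∇ r z‖ ^ 2 := by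
  have htaylor := (le_abs_self _).trans
    (abs_sub_sub_fderiv_le h.differentiable h.lipschitzWith_fderiv z (z + s • -∇ r z))
  rw [add_sub_cancel_left, map_smul, map_neg, ← inner_gradient_left, real_inner_self_eq_norm_sq,
    norm_smul, norm_neg, Real.norm_of_nonneg hs, smul_eq_mul] at htaylor
  nlinarith [mul_nonneg hs (sq_nonneg ‖∇ r z‖)]

theorem apply_sub_smul_gradient_le_sub_mul (h : IsDefiningFunction Ω r L K m)
    (hF : (frontier Ω).Nonempty) {ε : ℝ} (hε : K * ε ≤ 1 / 2) (hεm : K * ε ≤ m / 2) {z : E}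
    (hz : infDist z (frontier Ω) < ε) {s : ℝ} (hs : s ∈ Icc 0 ε) :
    r (z + s • -∇ r z) ≤ r z - m ^ 2 / 8 * s := by
  have hm := h.pos
  have hgrad : (m / 2) ^ 2 ≤ ‖∇ r z‖ ^ 2 := by
    gcongr
    have : K * infDist z (frontier Ω) ≤ K * ε := by gcongr
    rw [norm_gradient]
    linarith [h.sub_mul_infDist_le_norm_fderiv hF z]
  have hKs : K * s ≤ K * ε := by gcongr; exact hs.2
  have := h.apply_sub_smul_gradient_le hs.1 (hKs.trans hε) z
  nlinarith [hs.1]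

theorem exists_isInwardField_neg_gradient (h : IsDefiningFunction Ω r L K m)
    (hF : (frontier Ω).Nonempty) : ∃ ε c, IsInwardField Ω (fun z => -∇ r z) L K ε c := by
  have hm := h.pos
  set ε := min 1 m / (2 * (K + 1)) with hε_def
  have hε : 0 < ε := by positivity
  have hKε : K * ε ≤ min 1 m / 2 := by
    rw [hε_def, mul_div_assoc', div_le_div_iff₀ (by positivity) two_pos]
    nlinarith [lt_min one_pos hm]
  have hdecr : ∀ z, infDist z (frontier Ω) < ε → ∀ s ∈ Icc 0 ε,
      r (z + s • -∇ r z) ≤ r z - m ^ 2 / 8 * s := fun z hz s hs =>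
    h.apply_sub_smul_gradient_le_sub_mul hF (by linarith [min_le_left 1 m])
      (by linarith [min_le_right 1 m]) hz hs
  have hL : ∀ z, ‖-∇ r z‖ ≤ L := fun z => by
    rw [norm_neg, norm_gradient]
    exact norm_fderiv_le_of_lipschitz ℝ h.lipschitzWith
  refine ⟨ε, m ^ 2 / 8 / (m ^ 2 / 8 + L * (L + 1)), hL, ?_, hε, by positivity,
    fun z hz hzε s hs => ?_, fun z hz hzε s hs => ?_⟩
  · refine .of_dist_le_mul fun z w => ?_
    rw [dist_neg_neg, dist_eq_norm, dist_eq_norm, norm_gradient_sub_gradient]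
    exact h.lipschitzWith_fderiv.norm_sub_le z w
  · rw [h.mem_iff] at hz ⊢
    have := mul_nonneg (by positivity : 0 ≤ m ^ 2 / 8) hs.1
    linarith [hdecr z hzε s hs]
  · rw [h.mem_iff] at hz
    have hdepth : m ^ 2 / 8 * s ≤ L * infDist (z + s • -∇ r z) (frontier Ω) := by
      linarith [hdecr z hzε s hs, h.neg_le_mul_infDist hF (z + s • -∇ r z)]
    have hlip : infDist z (frontier Ω) - L * s ≤ infDist (z + s • -∇ r z) (frontier Ω) := by
      have hstep := infDist_sub_norm_sub_le (frontier Ω) z (z + s • -∇ r z)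
      rw [sub_add_cancel_left, norm_neg, norm_smul, Real.norm_of_nonneg hs.1] at hstep
      linarith [mul_le_mul_of_nonneg_left (hL z) hs.1]
    rw [div_mul_eq_mul_div, div_le_iff₀ (by positivity)]
    nlinarith [L.2, sq_nonneg m]

end IsDefiningFunction

/-! ### The derivative of the boundary distance along a bounded holomorphic map -/

theorem exists_infDist_le {E : Type*} [PseudoMetricSpace E] {Ω : Set E} (hΩ : IsBounded Ω)
    (s : Set E) : ∃ D, 0 ≤ D ∧ ∀ z ∈ Ω, infDist z s ≤ D := by
  obtain ⟨D, hD₀, hD⟩ := ((lipschitz_infDist_pt s).isBounded_image hΩ).exists_pos_norm_le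
  exact ⟨D, hD₀.le, fun z hz => (le_abs_self _).trans (hD _ (mem_image_of_mem _ hz))⟩

theorem norm_le_two_mul_sqrt {E : Type*} [NormedAddCommGroup E] [NormedSpace ℝ E] {f : E → ℝ}
    {l : E →L[ℝ] ℝ} {p : E} {ρ B : ℝ} (hρ : 0 < ρ) (hf : ∀ x ∈ ball p ρ, 0 ≤ f x)
    (hl : ∀ v, ‖v‖ < ρ → f (p + v) ≤ f p + l v + B * ‖v‖ ^ 2) (hp : 0 < f p)
    (hB : f p < B * ρ ^ 2) : ‖l‖ ≤ 2 * √(B * f p) := by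
  have hB₀ : 0 < B := pos_of_mul_pos_left (hp.trans hB) (by positivity)
  -- the step at which the quadratic term balances `f p`
  set t := √(f p / B) with ht_def
  have ht : 0 < t := by positivity
  have ht_sq : B * t ^ 2 = f p := by
    rw [ht_def, Real.sq_sqrt (by positivity), mul_div_cancel₀ _ hB₀.ne']
  have htρ : t < ρ := by
    rw [ht_def, Real.sqrt_lt' hρ, div_lt_iff₀' hB₀]
    exact hB
  have hsqrt : √(B * f p) = B * t := by
    rw [← ht_sq, show B * (B * t ^ 2) = (B * t) ^ 2 by ring, Real.sqrt_sq (by positivity)]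
  have hle : ∀ v, ‖v‖ = 1 → -l v ≤ 2 * (B * t) := fun v hv => by
    have hv' : ‖t • v‖ = t := by rw [norm_smul, hv, mul_one, Real.norm_of_nonneg ht.le]
    have hnonneg := (hf (p + t • v) (by simpa [hv'] using htρ)).trans (hl _ (hv'.trans_lt htρ))
    rw [hv', map_smul, smul_eq_mul, ← ht_sq] at hnonneg
    exact le_of_mul_le_mul_left (by linarith) ht
  rw [hsqrt]
  refine l.opNorm_le_of_unit_norm (by positivity) fun v hv => abs_le'.2 ⟨?_, hle v hv⟩
  simpa using hle (-v) (by rwa [norm_neg])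

namespace IsDefiningFunction

variable {E F : Type*} [NormedAddCommGroup E] [NormedSpace ℂ E] [NormedAddCommGroup F]
  {Ω : Set F} {r : F → ℝ} {L K : ℝ≥0} {m : ℝ} {Φ : E → F} {p : E} {ρ M A : ℝ}

theorem abs_sub_sub_fderiv_comp_le [NormedSpace ℂ F] (h : IsDefiningFunction Ω r L K m)
    (hd : DifferentiableOn ℂ Φ (ball p ρ)) (hM : ∀ x ∈ ball p ρ, ‖Φ x‖ ≤ M) {v : E} (hv : ‖v‖ < ρ) :
    |r (Φ (p + v)) - r (Φ p) - fderiv ℝ r (Φ p) (fderiv ℂ Φ p v)| ≤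
      (4 * K * M ^ 2 + 4 * L * M) / ρ ^ 2 * ‖v‖ ^ 2 := by
  have htaylor := abs_sub_sub_fderiv_le h.differentiable h.lipschitzWith_fderiv (Φ p) (Φ (p + v))
  have hfirst := norm_add_sub_le_of_norm_le hd hM hv
  have hsecond := norm_add_sub_sub_fderiv_le hd hM hv
  have hL : ‖fderiv ℝ r (Φ p)‖ ≤ L := norm_fderiv_le_of_lipschitz ℝ h.lipschitzWith
  have hlin := (fderiv ℝ r (Φ p)).le_of_opNorm_le_of_le hL hsecond
  rw [map_sub, Real.norm_eq_abs] at hlin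
  calc _ ≤ |r (Φ (p + v)) - r (Φ p) - fderiv ℝ r (Φ p) (Φ (p + v) - Φ p)| +
        |fderiv ℝ r (Φ p) (Φ (p + v) - Φ p) - fderiv ℝ r (Φ p) (fderiv ℂ Φ p v)| :=
        (abs_add_le _ _).trans_eq' (by congr 1; ring)
    _ ≤ K * (2 * M / ρ * ‖v‖) ^ 2 + L * (4 * M / ρ ^ 2 * ‖v‖ ^ 2) := by
        gcongr
        exact htaylor.trans (by gcongr)
    _ = _ := by ring

theorem norm_fderiv_comp_le [NormedSpace ℂ F] (h : IsDefiningFunction Ω r L K m)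
    (hρ : 0 < ρ) (hd : DifferentiableOn ℂ Φ (ball p ρ)) (hM : ∀ x ∈ ball p ρ, ‖Φ x‖ ≤ M)
    (hΦ : MapsTo Φ (ball p ρ) Ω) (hA : 4 * K * M ^ 2 + 4 * L * M ≤ A) (hp : -r (Φ p) < A) :
    ‖(fderiv ℝ r (Φ p)).comp ((fderiv ℂ Φ p).restrictScalars ℝ)‖ ≤ 2 * √(A * -r (Φ p)) / ρ := by
  have hneg : ∀ x ∈ ball p ρ, 0 < -r (Φ x) := fun x hx => neg_pos.2 (h.mem_iff.1 (hΦ hx))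
  have hlandau := norm_le_two_mul_sqrt (f := fun x => -r (Φ x)) (B := A / ρ ^ 2)
    (l := -(fderiv ℝ r (Φ p)).comp ((fderiv ℂ Φ p).restrictScalars ℝ)) hρ
    (fun x hx => (hneg x hx).le) (fun v hv => ?_) (hneg p (mem_ball_self hρ))
    (by rwa [div_mul_cancel₀ _ (by positivity)])
  · rwa [norm_neg, div_mul_eq_mul_div, Real.sqrt_div' _ (by positivity), Real.sqrt_sq hρ.le,
      mul_div_assoc'] at hlandau
  · have htaylor := neg_le_of_abs_le (h.abs_sub_sub_fderiv_comp_le hd hM hv)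
    have : (4 * K * M ^ 2 + 4 * L * M) / ρ ^ 2 * ‖v‖ ^ 2 ≤ A / ρ ^ 2 * ‖v‖ ^ 2 := by gcongr
    simp only [neg_apply, ContinuousLinearMap.comp_apply,
      ContinuousLinearMap.coe_restrictScalars']
    linarith

theorem mul_norm_fderiv_infDist_comp_le {E F : Type*} [NormedAddCommGroup E] [NormedSpace ℝ E]
    [NormedAddCommGroup F] [InnerProductSpace ℝ F] [ProperSpace F] {Ω : Set F} {r : F → ℝ}
    (h : IsDefiningFunction Ω r L K m) (hF : (frontier Ω).Nonempty) {q : F} (hq : q ∈ Ω)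
    (T : E →L[ℝ] F) :
    m * ‖(fderiv ℝ (infDist · (frontier Ω)) q).comp T‖ ≤
      ‖(fderiv ℝ r q).comp T‖ + K * infDist q (frontier Ω) * ‖T‖ := by
  by_cases hd : DifferentiableAt ℝ (infDist · (frontier Ω)) q
  swap
  · rw [fderiv_zero_of_not_differentiableAt hd, ContinuousLinearMap.zero_comp, norm_zero, mul_zero]
    have := infDist_nonneg (x := q) (s := frontier Ω)
    positivity
  obtain ⟨a, ⟨hma, -⟩, ha⟩ := h.exists_norm_gradient_add_smul_gradient_infDist_le hF hq hd
  rw [gradient, gradient, ← LinearIsometryEquiv.map_smul, ← map_add, LinearIsometryEquiv.norm_map]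
    at ha
  have ha₀ : 0 ≤ a := h.pos.le.trans hma
  set l := fderiv ℝ (infDist · (frontier Ω)) q
  calc m * ‖l.comp T‖ ≤ ‖a • l.comp T‖ := by
        rw [norm_smul, Real.norm_of_nonneg ha₀]
        gcongr
    _ = ‖(fderiv ℝ r q + a • l).comp T - (fderiv ℝ r q).comp T‖ := by
        congr 1; ext v; simp
    _ ≤ ‖(fderiv ℝ r q + a • l).comp T‖ + ‖(fderiv ℝ r q).comp T‖ := norm_sub_le _ _
    _ ≤ K * infDist q (frontier Ω) * ‖T‖ + ‖(fderiv ℝ r q).comp T‖ := by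
        gcongr
        exact (ContinuousLinearMap.opNorm_comp_le _ _).trans (by gcongr)
    _ = _ := add_comm _ _

theorem exists_norm_fderiv_infDist_comp_le {n : ℕ} {Ω : Set (Cn n)} {r : Cn n → ℝ}
    (h : IsDefiningFunction Ω r L K m) (hF : (frontier Ω).Nonempty) (hb : IsBounded Ω) :
    ∃ A, ∀ (Φ : E → Cn n) (p : E) (ρ : ℝ), 0 < ρ → DifferentiableOn ℂ Φ (ball p ρ) →
      MapsTo Φ (ball p ρ) Ω →
        ‖(fderiv ℝ (infDist · (frontier Ω)) (Φ p)).comp ((fderiv ℂ Φ p).restrictScalars ℝ)‖ ≤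
          A * √(infDist (Φ p) (frontier Ω)) / ρ := by
  have hm := h.pos
  obtain ⟨M, hM₀, hM⟩ := hb.exists_pos_norm_le
  obtain ⟨D, hD₀, hD⟩ := exists_infDist_le hb (frontier Ω)
  obtain ⟨A, hAM, hAD⟩ : ∃ A, 4 * K * M ^ 2 + 4 * L * M ≤ A ∧ L * D < A :=
    ⟨4 * K * M ^ 2 + 4 * L * M + L * D + 1, by linarith [mul_nonneg L.coe_nonneg hD₀],
      by linarith [show 0 ≤ 4 * K * M ^ 2 + 4 * L * M by positivity]⟩
  have hA₀ : 0 ≤ A := hAM.trans' (by positivity)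
  refine ⟨(2 * √(A * L) + 2 * K * M * √D) / m, fun Φ p ρ hρ hd hΦ => ?_⟩
  have hp := hΦ (mem_ball_self hρ)
  have hΦM : ∀ x ∈ ball p ρ, ‖Φ x‖ ≤ M := fun x hx => hM _ (hΦ hx)
  set δ := infDist (Φ p) (frontier Ω)
  have hδ : 0 ≤ δ := infDist_nonneg
  have hrδ : -r (Φ p) ≤ L * δ := h.neg_le_mul_infDist hF _
  have hr : ‖(fderiv ℝ r (Φ p)).comp ((fderiv ℂ Φ p).restrictScalars ℝ)‖ ≤
      2 * (√(A * L) * √δ) / ρ := by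
    have hrA : -r (Φ p) < A := (hrδ.trans (by gcongr; exact hD _ hp)).trans_lt hAD
    refine (h.norm_fderiv_comp_le hρ hd hΦM hΦ hAM hrA).trans ?_
    rw [← Real.sqrt_mul (by positivity), mul_assoc A]
    gcongr
  have hδ_sqrt : δ ≤ √D * √δ := by
    rw [← Real.sqrt_mul hD₀, Real.le_sqrt hδ (by positivity), pow_two]
    exact mul_le_mul_of_nonneg_right (hD _ hp) hδ
  have hT : ‖(fderiv ℂ Φ p).restrictScalars ℝ‖ ≤ 2 * M / ρ := by
    rw [ContinuousLinearMap.norm_restrictScalars]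
    exact norm_fderiv_le_of_norm_le hρ hd hΦM
  rw [div_mul_eq_mul_div, div_div, mul_comm m, ← div_div, le_div_iff₀' hm]
  calc _ ≤ _ := h.mul_norm_fderiv_infDist_comp_le hF hp _
    _ ≤ 2 * (√(A * L) * √δ) / ρ + K * (√D * √δ) * (2 * M / ρ) := by gcongr
    _ = _ := by ring

end IsDefiningFunction

section Coordinates

variable {n : ℕ}

theorem complexNormal_eq_smul_gradient (Ω : Set (Cn n)) (p : Cn n) :
    complexNormal Ω p = √2 • ∇ (signedDist Ω) p := by
  ext j
  have hx : partialX (signedDist Ω) p j = (∇ (signedDist Ω) p j).re := by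
    rw [partialX, ← inner_gradient_left, PiLp.inner_apply]
    simp [Complex.inner, apply_ite Complex.re]
  have hy : partialY (signedDist Ω) p j = (∇ (signedDist Ω) p j).im := by
    rw [partialY, ← inner_gradient_left, PiLp.inner_apply]
    simp [Complex.inner, apply_ite Complex.re]
  have hz : (∇ (signedDist Ω) p j).re + Complex.I * (∇ (signedDist Ω) p j).im =
      ∇ (signedDist Ω) p j := by rw [mul_comm, Complex.re_add_im]
  rw [PiLp.smul_apply, Complex.real_smul]
  simp only [complexNormal, partialZBar, hx, hy, hz]
  ring

theorem delPairing_eq_extendRCLike (u : Cn n → ℝ) (q x : Cn n) :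
    delPairing u q x = StrongDual.extendRCLike (𝕜 := ℂ) (fderiv ℝ u q) x / 2 := by
  conv_rhs => rw [← (EuclideanSpace.basisFun (Fin n) ℂ).sum_repr x, map_sum, Finset.sum_div]
  refine Finset.sum_congr rfl fun j _ => ?_
  have hI : Complex.I • EuclideanSpace.single j (1 : ℂ) = EuclideanSpace.single j Complex.I := by
    ext k
    simp
  simp only [partialZ, partialX, partialY, StrongDual.extendRCLike_apply, map_smul, smul_eq_mul,
    EuclideanSpace.basisFun_repr, EuclideanSpace.basisFun_apply, hI,
    RCLike.ofReal_eq_complex_ofReal, RCLike.I_to_complex]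
  ring

theorem norm_delPairing_le {E : Type*} [NormedAddCommGroup E] [NormedSpace ℂ E]
    (T : E →L[ℂ] Cn n) (u : Cn n → ℝ) (q : Cn n) (x : E) :
    ‖delPairing u q (T x)‖ ≤ ‖(fderiv ℝ u q).comp (T.restrictScalars ℝ)‖ / 2 * ‖x‖ := by
  have hcomp : StrongDual.extendRCLike (𝕜 := ℂ) (fderiv ℝ u q) (T x) =
      StrongDual.extendRCLike (𝕜 := ℂ) ((fderiv ℝ u q).comp (T.restrictScalars ℝ)) x := by
    simp [StrongDual.extendRCLike_apply]
  rw [delPairing_eq_extendRCLike, hcomp, norm_div, Complex.norm_two, div_mul_eq_mul_div]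
  gcongr
  exact StrongDual.norm_extendRCLike_bound _ x

end Coordinates

/-! ### The derivative in the normal direction -/

theorem frontier_nonempty {E : Type*} [NormedAddCommGroup E] [NormedSpace ℝ E] [Nontrivial E]
    {Ω : Set E} (hb : IsBounded Ω) (hne : Ω.Nonempty) : (frontier Ω).Nonempty :=
  nonempty_frontier_iff.2 ⟨hne, fun h => NormedSpace.unbounded_univ ℝ E (h ▸ hb)⟩

theorem exists_forall_infDist_frontier_lt_mem {E : Type*} [PseudoMetricSpace E] [ProperSpace E]
    {Ω U : Set E} (hb : IsBounded Ω) (hF : (frontier Ω).Nonempty) (hU : IsOpen U)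
    (hsub : frontier Ω ⊆ U) : ∃ t, 0 < t ∧ ∀ z, infDist z (frontier Ω) < t → z ∈ U := by
  have hcompact : IsCompact (frontier Ω) :=
    isCompact_of_isClosed_isBounded isClosed_frontier (hb.closure.subset frontier_subset_closure)
  obtain ⟨t, ht, htU⟩ := hcompact.exists_thickening_subset_open hU hsub
  exact ⟨t, ht, fun z hz => htU ((mem_thickening_iff_infDist_lt hF).2 hz)⟩

theorem dense_setOf_differentiableAt_infDist {E : Type*} [NormedAddCommGroup E] [NormedSpace ℝ E]
    [FiniteDimensional ℝ E] (s : Set E) : Dense {x | DifferentiableAt ℝ (infDist · s) x} := by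
  borelize E
  exact MeasureTheory.Measure.dense_of_ae (μ := MeasureTheory.Measure.addHaar)
    (lipschitz_infDist_pt s).ae_differentiableAt

variable {n : ℕ} {Ω Ω₁ Ω₂ : Set (Cn n)} {r : Cn n → ℝ} {L K : ℝ≥0} {m M α β : ℝ}
  {Φ : Cn n → Cn n} {p : Cn n}

theorem fderiv_signedDist (hΩ : IsOpen Ω) (hp : p ∈ Ω) :
    fderiv ℝ (signedDist Ω) p = -fderiv ℝ (infDist · (frontier Ω)) p := by
  rw [← fderiv_fun_neg]
  refine EventuallyEq.fderiv_eq ?_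
  filter_upwards [hΩ.mem_nhds hp] with z hz
  exact if_pos hz

theorem complexNormal_eq_neg_smul_gradient_infDist (hΩ : IsOpen Ω) (hp : p ∈ Ω) :
    complexNormal Ω p = -(√2 • ∇ (infDist · (frontier Ω)) p) := by
  rw [complexNormal_eq_smul_gradient, gradient, fderiv_signedDist hΩ hp, map_neg, smul_neg]
  rfl

theorem norm_gradient_infDist_le (s : Set (Cn n)) (p : Cn n) : ‖∇ (infDist · s) p‖ ≤ 1 := by
  rw [norm_gradient]
  exact norm_fderiv_le_of_lipschitz ℝ (lipschitz_infDist_pt s)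

theorem UniformlyPreservesComplexNormal.exists_norm_fderiv_apply_gradient_infDist_le
    (hN : UniformlyPreservesComplexNormal Φ Ω₁ Ω₂) (hΩ₁ : IsOpen Ω₁) (hΩ₂ : IsOpen Ω₂)
    (hΦ : MapsTo Φ Ω₁ Ω₂) :
    ∃ U, IsOpen U ∧ frontier Ω₁ ⊆ U ∧ ∃ C, 0 < C ∧ ∀ p ∈ Ω₁ ∩ U,
      ‖fderiv ℂ Φ p (∇ (infDist · (frontier Ω₁)) p)‖ ≤
        C * ‖(fderiv ℝ (infDist · (frontier Ω₂)) (Φ p)).comp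
          ((fderiv ℂ Φ p).restrictScalars ℝ)‖ := by
  obtain ⟨U, hU, hsub, C, hC, hN⟩ := hN
  refine ⟨U, hU, hsub, C, hC, fun p hp => ?_⟩
  have hpair := norm_delPairing_le (fderiv ℂ Φ p) (signedDist Ω₂) (Φ p) (complexNormal Ω₁ p)
  rw [fderiv_signedDist hΩ₂ (hΦ hp.1), ContinuousLinearMap.neg_comp, norm_neg] at hpair
  have hbound := (hN p hp).trans (mul_le_mul_of_nonneg_left hpair hC.le)
  rw [complexNormal_eq_neg_smul_gradient_infDist hΩ₁ hp.1, map_neg, norm_neg, norm_neg,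
    ContinuousLinearMap.map_smul_of_tower, norm_smul, norm_smul,
    Real.norm_of_nonneg (by positivity)] at hbound
  set l := (fderiv ℝ (infDist · (frontier Ω₂)) (Φ p)).comp ((fderiv ℂ Φ p).restrictScalars ℝ)
  refine le_of_mul_le_mul_left (a := √2) (hbound.trans ?_) (by positivity)
  calc C * (‖l‖ / 2 * (√2 * ‖∇ (infDist · (frontier Ω₁)) p‖))
      ≤ C * (‖l‖ * (√2 * 1)) := by
        gcongr
        · exact half_le_self (norm_nonneg l)
        · exact norm_gradient_infDist_le _ p
    _ = √2 * (C * ‖l‖) := by ring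

theorem exists_norm_fderiv_apply_gradient_infDist_le_rpow
    (h₂ : IsDefiningFunction Ω₂ r L K m) (hb₂ : IsBounded Ω₂) (hF₂ : (frontier Ω₂).Nonempty)
    (hΩ₁ : IsOpen Ω₁) (hF₁ : (frontier Ω₁).Nonempty) (hd : DifferentiableOn ℂ Φ Ω₁)
    (hΦ : MapsTo Φ Ω₁ Ω₂) (hN : UniformlyPreservesComplexNormal Φ Ω₁ Ω₂)
    (hDF : BoundaryDistanceProperty Φ Ω₁ Ω₂ α) :
    ∃ U, IsOpen U ∧ frontier Ω₁ ⊆ U ∧ ∃ C, ∀ p ∈ Ω₁ ∩ U,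
      ‖fderiv ℂ Φ p (∇ (infDist · (frontier Ω₁)) p)‖ ≤
        C * infDist p (frontier Ω₁) ^ (α / 2 - 1) := by
  obtain ⟨U, hU, hsub, C, hC, hN⟩ :=
    hN.exists_norm_fderiv_apply_gradient_infDist_le hΩ₁ h₂.isOpen hΦ
  obtain ⟨A, hA⟩ := h₂.exists_norm_fderiv_infDist_comp_le (E := Cn n) hF₂ hb₂
  obtain ⟨B, hB, hDF⟩ := hDF
  refine ⟨U, hU, hsub, C * (|A| * √B), fun p hp => ?_⟩
  have hball := ball_infDist_frontier_subset hΩ₁ hp.1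
  have hpos := infDist_frontier_pos hΩ₁ hF₁ hp.1
  have hcomp := hA Φ p _ hpos (hd.mono hball) (hΦ.mono_left hball)
  set d := infDist p (frontier Ω₁)
  have hsqrt : √(infDist (Φ p) (frontier Ω₂)) ≤ √B * d ^ (α / 2) := by
    rw [← mul_one_div α, Real.rpow_mul hpos.le, ← Real.sqrt_eq_rpow, ← Real.sqrt_mul hB.le]
    exact Real.sqrt_le_sqrt (hDF p hp.1)
  calc _ ≤ C * (A * √(infDist (Φ p) (frontier Ω₂)) / d) := (hN p hp).trans (by gcongr)
    _ ≤ C * (|A| * (√B * d ^ (α / 2)) / d) := by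
        gcongr
        exact le_abs_self A
    _ = C * (|A| * √B) * d ^ (α / 2 - 1) := by rw [Real.rpow_sub_one hpos.ne']; ring

theorem IsDefiningFunction.norm_apply_gradient_le {F : Type*} [NormedAddCommGroup F]
    [NormedSpace ℂ F] (h : IsDefiningFunction Ω r L K m) (hF : (frontier Ω).Nonempty) (hp : p ∈ Ω)
    (hd : DifferentiableAt ℝ (infDist · (frontier Ω)) p) (T : Cn n →L[ℂ] F) :
    ‖T (∇ r p)‖ ≤
      L * ‖T (∇ (infDist · (frontier Ω)) p)‖ + K * infDist p (frontier Ω) * ‖T‖ := by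
  obtain ⟨a, ⟨hma, haL⟩, ha⟩ := h.exists_norm_gradient_add_smul_gradient_infDist_le hF hp hd
  have hT := T.le_opNorm_of_le ha
  have ha₀ : 0 ≤ a := h.pos.le.trans hma
  set u := ∇ (infDist · (frontier Ω)) p
  calc ‖T (∇ r p)‖ = ‖T (∇ r p + a • u) - a • T u‖ := by
        rw [map_add, T.map_smul_of_tower, add_sub_cancel_right]
    _ ≤ ‖T (∇ r p + a • u)‖ + ‖a • T u‖ := norm_sub_le _ _
    _ ≤ K * infDist p (frontier Ω) * ‖T‖ + L * ‖T u‖ := by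
        rw [norm_smul, Real.norm_of_nonneg ha₀]
        gcongr
        linarith
    _ = _ := add_comm _ _

theorem IsDefiningFunction.exists_norm_fderiv_apply_gradient_le_of_differentiableAt
    (h : IsDefiningFunction Ω r L K m) (hb : IsBounded Ω) (hF : (frontier Ω).Nonempty)
    (hd : DifferentiableOn ℂ Φ Ω) (hM : ∀ z ∈ Ω, ‖Φ z‖ ≤ M) (hβ : β ≤ 1) {U : Set (Cn n)}
    {C : ℝ} (hU : IsOpen U) (hsub : frontier Ω ⊆ U)
    (hC : ∀ p ∈ Ω ∩ U, ‖fderiv ℂ Φ p (∇ (infDist · (frontier Ω)) p)‖ ≤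
      C * infDist p (frontier Ω) ^ (β - 1)) :
    ∃ A, ∀ p ∈ Ω, DifferentiableAt ℝ (infDist · (frontier Ω)) p →
      ‖fderiv ℂ Φ p (∇ r p)‖ ≤ A * infDist p (frontier Ω) ^ (β - 1) := by
  obtain ⟨t, ht, htU⟩ := exists_forall_infDist_frontier_lt_mem hb hF hU hsub
  obtain ⟨D, -, hD⟩ := exists_infDist_le hb (frontier Ω)
  refine ⟨L * |C| + (2 * K * M + 2 * L * M / t) / D ^ (β - 1), fun p hp hdiff => ?_⟩
  have hM₀ : 0 ≤ M := (norm_nonneg _).trans (hM p hp)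
  have hpos := infDist_frontier_pos h.isOpen hF hp
  refine le_trans ?_ (mul_rpow_add_le_mul_rpow hpos (hD p hp) (by linarith) (by positivity))
  have hCauchy := norm_fderiv_le_div_infDist h.isOpen hd hM hp hpos
  set d := infDist p (frontier Ω)
  rcases lt_or_ge d t with hdt | htd
  · calc _ ≤ _ := h.norm_apply_gradient_le hF hp hdiff (fderiv ℂ Φ p)
      _ ≤ L * (|C| * d ^ (β - 1)) + K * d * (2 * M / d) := by
          gcongr
          refine (hC p ⟨hp, htU p hdt⟩).trans ?_
          gcongr
          exact le_abs_self C
      _ = L * |C| * d ^ (β - 1) + 2 * K * M := by field_simp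
      _ ≤ _ := by gcongr; exact le_add_of_nonneg_right (by positivity)
  · have hgrad : ‖∇ r p‖ ≤ L :=
      norm_gradient.trans_le (norm_fderiv_le_of_lipschitz ℝ h.lipschitzWith)
    calc _ ≤ 2 * M / d * L := (fderiv ℂ Φ p).le_of_opNorm_le_of_le hCauchy hgrad
      _ ≤ 2 * M / t * L := by gcongr
      _ = 2 * L * M / t := by ring
      _ ≤ _ := by
          rw [← add_assoc]
          exact le_add_of_nonneg_left (by positivity)

theorem IsDefiningFunction.norm_fderiv_apply_gradient_le_of_differentiableAt
    (h : IsDefiningFunction Ω r L K m) (hF : (frontier Ω).Nonempty)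
    (hd : DifferentiableOn ℂ Φ Ω) (hM : ∀ z ∈ Ω, ‖Φ z‖ ≤ M) {A : ℝ}
    (hA : ∀ p ∈ Ω, DifferentiableAt ℝ (infDist · (frontier Ω)) p →
      ‖fderiv ℂ Φ p (∇ r p)‖ ≤ A * infDist p (frontier Ω) ^ (β - 1)) (hp : p ∈ Ω) :
    ‖fderiv ℂ Φ p (∇ r p)‖ ≤ A * infDist p (frontier Ω) ^ (β - 1) := by
  have hpos := infDist_frontier_pos h.isOpen hF hp
  have hball := ball_infDist_frontier_subset h.isOpen hp
  have hgrad : Continuous (∇ r) :=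
    (InnerProductSpace.toDual ℝ (Cn n)).symm.continuous.comp h.lipschitzWith_fderiv.continuous
  have hleft : ContinuousAt (fun z => ‖fderiv ℂ Φ z (∇ r z)‖) p :=
    ((continuousAt_fderiv hpos (hd.mono hball) fun z hz => hM z (hball hz)).clm_apply
      hgrad.continuousAt).norm
  have hright : ContinuousAt (fun z => A * infDist z (frontier Ω) ^ (β - 1)) p :=
    ((continuous_infDist_pt _).continuousAt.rpow_const (Or.inl hpos.ne')).const_mul A
  have hp' := (dense_setOf_differentiableAt_infDist (frontier Ω)).open_subset_closure_inter
    h.isOpen hp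
  exact ContinuousWithinAt.closure_le hp' hleft.continuousWithinAt hright.continuousWithinAt
    fun z hz => hA z hz.1 hz.2

theorem IsDefiningFunction.exists_norm_sub_le_rpow (h : IsDefiningFunction Ω r L K m)
    (hF : (frontier Ω).Nonempty) (hd : DifferentiableOn ℂ Φ Ω) (hM : ∀ z ∈ Ω, ‖Φ z‖ ≤ M)
    (hβ₀ : 0 < β) (hβ₁ : β < 1) {A : ℝ}
    (hA : ∀ p ∈ Ω, ‖fderiv ℂ Φ p (∇ r p)‖ ≤ A * infDist p (frontier Ω) ^ (β - 1)) :
    ∃ C, ∀ z ∈ Ω, ∀ w ∈ Ω, ‖Φ z - Φ w‖ ≤ C * ‖z - w‖ ^ β := by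
  obtain ⟨ε, c, hV⟩ := h.exists_isInwardField_neg_gradient hF
  obtain ⟨B, hB⟩ := hV.exists_norm_fderiv_le_rpow h.isOpen hd hM hβ₀.le hβ₁ fun z hz => by
    rw [map_neg, norm_neg]
    exact hA z hz
  refine hV.exists_norm_sub_le_rpow h.isOpen (hd.restrictScalars ℝ) hM hβ₀ hβ₁.le (C := B)
    fun z hz => ?_
  rw [(hd.differentiableAt (h.isOpen.mem_nhds hz)).fderiv_restrictScalars ℝ,
    ContinuousLinearMap.norm_restrictScalars]
  exact hB z hz

end NormalMapping

open NormalMapping Bornology Set in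
open scoped NNReal in
theorem theorem3p1_general {n : ℕ} {Ω₁ Ω₂ : Set (Cn n)} {r₁ r₂ : Cn n → ℝ} {L₁ K₁ L₂ K₂ : ℝ≥0}
    {m₁ m₂ : ℝ} (h₁ : IsDefiningFunction Ω₁ r₁ L₁ K₁ m₁) (h₂ : IsDefiningFunction Ω₂ r₂ L₂ K₂ m₂)
    (hb₁ : IsBounded Ω₁) (hb₂ : IsBounded Ω₂) {Φ : Cn n → Cn n} (hd : DifferentiableOn ℂ Φ Ω₁)
    (hΦ : MapsTo Φ Ω₁ Ω₂) (hN : UniformlyPreservesComplexNormal Φ Ω₁ Ω₂) {α : ℝ} (hα₀ : 0 < α)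
    (hα₂ : α < 2) (hDF : BoundaryDistanceProperty Φ Ω₁ Ω₂ α) : InLip (α / 2) Φ Ω₁ := by
  obtain ⟨M, -, hM⟩ := hb₂.exists_pos_norm_le
  have hΦM : ∀ z ∈ Ω₁, ‖Φ z‖ ≤ M := fun z hz => hM _ (hΦ hz)
  refine ⟨⟨M, hΦM⟩, ?_⟩
  rcases subsingleton_or_nontrivial (Cn n) with _ | _
  · exact ⟨0, fun z _ w _ => by simp [Subsingleton.elim z w]⟩
  rcases Ω₁.eq_empty_or_nonempty with rfl | hne
  · exact ⟨0, fun z hz => hz.elim⟩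
  have hF₁ : (frontier Ω₁).Nonempty := frontier_nonempty hb₁ hne
  have hF₂ : (frontier Ω₂).Nonempty := frontier_nonempty hb₂ (hne.image Φ |>.mono hΦ.image_subset)
  obtain ⟨U, hU, hsub, C, hC⟩ := exists_norm_fderiv_apply_gradient_infDist_le_rpow
    h₂ hb₂ hF₂ h₁.isOpen hF₁ hd hΦ hN hDF
  obtain ⟨A, hA⟩ := h₁.exists_norm_fderiv_apply_gradient_le_of_differentiableAt
    hb₁ hF₁ hd hΦM (by linarith) hU hsub hC
  exact h₁.exists_norm_sub_le_rpow hF₁ hd hΦM (by linarith) (by linarith) fun p hp =>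
    h₁.norm_fderiv_apply_gradient_le_of_differentiableAt hF₁ hd hΦM hA hp

open NormalMapping in
theorem theorem3p1 {n : ℕ} (Ω₁ Ω₂ : Set (Cn n))
    (hΩ₁ : IsBoundedC2Domain Ω₁) (hΩ₂ : IsBoundedC2Domain Ω₂)
    (Φ : Cn n → Cn n) (hΦ : IsProperHolomorphic Φ Ω₁ Ω₂)
    (hN : UniformlyPreservesComplexNormal Φ Ω₁ Ω₂)
    (α : ℝ) (hα₀ : 0 < α) (hα₁ : α ≤ 1)
    (hDF : BoundaryDistanceProperty Φ Ω₁ Ω₂ α) :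
    InLip (α / 2) Φ Ω₁ := by
  obtain ⟨_, hr₁, hlt₁, hdr₁⟩ := hΩ₁.exists_definingFunction
  obtain ⟨_, hr₂, hlt₂, hdr₂⟩ := hΩ₂.exists_definingFunction
  obtain ⟨_, _, _, _, h₁⟩ := exists_isDefiningFunction hΩ₁.isBounded hr₁ hlt₁ hdr₁
  obtain ⟨_, _, _, _, h₂⟩ := exists_isDefiningFunction hΩ₂.isBounded hr₂ hlt₂ hdr₂
  exact theorem3p1_general h₁ h₂ hΩ₁.isBounded hΩ₂.isBounded hΦ.1 hΦ.2.1 hN hα₀ (by linarith) hDF
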